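/- An MDP consists of a finite directed graph with vertex set $V$ in which every vertex has a successor, a partition of $V$ into player-0 vertices and probabilistic vertices, and for every probabilistic vertex $u$ a probability distribution $\delta(u)$ on $V$ whose support is exactly the set of successors of $u$. A strategy of player 0 chooses, depending on the history and possibly at random, a successor whenever the play is in a player-0 vertex. An end-component is a nonempty set $U$ of vertices such that any two (possibly equal) vertices of $U$ are connected by a path of length at least one inside $U$ and no edge leads from a probabilistic vertex of $U$ out of $U$; a MEC is an inclusion-maximal end-component. A condition of $k$ generalized Rabin pairs $(F_i,\{I_i^1,\dots,I_i^{\ell_i}\})$, $i=1,\dots,k$, with $F_i,I_i^j\subseteq V$, accepts a play if for some $i$ the set $\mathrm{Inf}$ of vertices visited infinitely often satisfies $F_i\cap\mathrm{Inf}=\emptyset$ and $I_i^j\cap\mathrm{Inf}\neq\emptyset$ for all $j$. The optimal value at a vertex $v$ is the supremum, over all strategies, of the probability that the play from $v$ is accepted. Theorem. (a) Let $W_i$ be the union of those sets $C$ that are maximal among the end-components disjoint from $F_i$ (the MECs after $F_i$ has been removed) and that meet $I_i^j$ for every $j=1,\dots,\ell_i$, and let $W=\bigcup_{i=1}^k W_i$.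 Then for every vertex $v$ the optimal value at $v$ equals the maximal probability, over all strategies, of reaching $W$ from $v$, and this maximum is attained. (b) Work with programs for a random access machine with unit-cost addition and subtraction of natural numbers, unit-cost field operations and comparisons of real numbers, and subroutine calls; reading an input counts one step per input cell. Let $\mathsf{MEC}(n,m)$ be any bound such that some program computes the MEC decomposition of every MDP graph with at most $n$ vertices and at most $m$ edges in time $\mathsf{MEC}(n,m)$, and let $\mathsf{LP}(n,m)$ be any bound such that some program finds an optimal solution of every linear program $\min\{c\cdot x : Ax\ge b,\ x\ge 0\}$ with at most $n$ variables and at most $m$ constraints that has an optimal solution (with $A$ given as a dense matrix) in time $\mathsf{LP}(n,m)$. Then some program computes, given any MDP with $n$ vertices and $m$ edges and any $k$ generalized Rabin pairs (given by characteristic vectors), the optimal value at every vertex in time $$\mathcal O\Big(k\cdot\mathsf{MEC}(n,m)+n\cdot\sum_{i=1}^k\ell_i\Big)+\mathcal O(\mathsf{LP}(n,m)),$$ where the constants in $\mathcal O$ are absolute. -/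

import Mathlib

open MeasureTheory ProbabilityTheory
open scoped ENNReal

namespace GRPModel

/-! ## Markov decision processes -/

/-- A finite directed graph whose vertex set is partitioned into the probabilistic vertices `VP`
and the player-0 vertices (all the others). Every vertex has a successor, so that plays are
infinite. -/
structure MDPGraph (V : Type*) where
  E : V → V → Prop
  VP : Set V
  total : ∀ u, ∃ v, E u v

/-- A Markov decision process: an MDP graph with a transition distribution `δ u` for every
probabilistic vertex `u`, whose support is the set of successors of `u`. -/
structure MDP (V : Type*) extends MDPGraph V where
  δ : VP → PMF V
  edge_iff : ∀ (u : VP) (v : V), E u v ↔ 0 < δ u v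

/-- An end-component: a nonempty set `U` such that any two (possibly equal) vertices of `U` are
joined by a path of length at least one inside `U`, and such that no edge leads from a
probabilistic vertex of `U` out of `U`. -/
structure MDPGraph.IsEC {V : Type*} (G : MDPGraph V) (U : Set V) : Prop where
  nonempty : U.Nonempty
  connected : ∀ u ∈ U, ∀ v ∈ U, Relation.TransGen (fun a b => a ∈ U ∧ b ∈ U ∧ G.E a b) u v
  closed : ∀ u v, G.E u v → u ∈ U → u ∈ G.VP → v ∈ U

/-- A maximal end-component. -/
def MDPGraph.IsMEC {V : Type*} (G : MDPGraph V) (C : Set V) : Prop :=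
  Maximal G.IsEC C

/-- A maximal end-component after the set `F` has been removed. (An edge from a probabilistic
vertex into `F` still leaves every set that is disjoint from `F`.) -/
def MDPGraph.IsMECWithout {V : Type*} (G : MDPGraph V) (F : Set V) (C : Set V) : Prop :=
  Maximal (fun U => G.IsEC U ∧ Disjoint U F) C

/-! ## Strategies, plays and values -/

/-- A (randomized, history-dependent) strategy of player 0. A history is a sequence
`v_0, …, v_n` of vertices. -/
structure MDP.Strategy {V : Type*} (M : MDP V) where
  choose : (n : ℕ) → (Finset.Iic n → V) → PMF V
  legal : ∀ (n : ℕ) (h : Finset.Iic n → V) (v : V),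
    h ⟨n, Finset.mem_Iic.2 le_rfl⟩ ∉ M.VP → 0 < choose n h v →
      M.E (h ⟨n, Finset.mem_Iic.2 le_rfl⟩) v

open Classical in
/-- The distribution of the next vertex after a history `h`. -/
noncomputable def MDP.next {V : Type*} (M : MDP V) (σ : M.Strategy) (n : ℕ)
    (h : Finset.Iic n → V) : PMF V :=
  if hp : h ⟨n, Finset.mem_Iic.2 le_rfl⟩ ∈ M.VP then M.δ ⟨_, hp⟩ else σ.choose n h

/-- `MDP.next` as a probability kernel. -/
noncomputable def MDP.kernel {V : Type*} [Finite V] [MeasurableSpace V]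
    [MeasurableSingletonClass V] (M : MDP V) (σ : M.Strategy) (n : ℕ) :
    Kernel (Finset.Iic n → V) V :=
  Kernel.ofFunOfCountable fun h => (M.next σ n h).toMeasure

instance {V : Type*} [Finite V] [MeasurableSpace V] [MeasurableSingletonClass V] (M : MDP V)
    (σ : M.Strategy) (n : ℕ) : IsMarkovKernel (M.kernel σ n) :=
  ⟨fun h => PMF.toMeasure.isProbabilityMeasure (M.next σ n h)⟩

/-- The law of the infinite play from `v` under the strategy `σ`. -/
noncomputable def MDP.law {V : Type*} [Finite V] [MeasurableSpace V]
    [MeasurableSingletonClass V] (M : MDP V) (σ : M.Strategy) (v : V) : Measure (ℕ → V) :=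
  Kernel.traj (X := fun _ => V) (M.kernel σ) 0 (fun _ => v)

/-- The optimal value at `v` of the objective `A`: the supremum over all strategies of the
probability of `A`. -/
noncomputable def MDP.value {V : Type*} [Finite V] [MeasurableSpace V]
    [MeasurableSingletonClass V] (M : MDP V) (A : Set (ℕ → V)) (v : V) : ℝ≥0∞ :=
  ⨆ σ : M.Strategy, M.law σ v A

/-- The plays that visit `W`. -/
def reach {V : Type*} (W : Set V) : Set (ℕ → V) := {ρ | ∃ i, ρ i ∈ W}

/-! ## Generalized Rabin pairs -/

/-- A generalized Rabin pair `(F, {I^1, …, I^ℓ})`. -/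
structure GRPair (V : Type*) where
  F : Set V
  I : List (Set V)

/-- The set of vertices visited infinitely often. -/
def infSet {V : Type*} (ρ : ℕ → V) : Set V := {v | ∃ᶠ i in Filter.atTop, ρ i = v}

/-- The plays accepted by a disjunction of generalized Rabin pairs. -/
def accepted {V : Type*} (GR : List (GRPair V)) : Set (ℕ → V) :=
  {ρ | ∃ p ∈ GR, p.F ∩ infSet ρ = ∅ ∧ ∀ S ∈ p.I, (S ∩ infSet ρ).Nonempty}

/-- The union of the winning maximal end-components for one pair. -/
def MDPGraph.winningSet {V : Type*} (G : MDPGraph V) (p : GRPair V) : Set V :=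
  ⋃₀ {C | G.IsMECWithout p.F C ∧ ∀ S ∈ p.I, (C ∩ S).Nonempty}

/-- The union over all pairs. -/
def MDPGraph.winning {V : Type*} (G : MDPGraph V) (GR : List (GRPair V)) : Set V :=
  {v | ∃ p ∈ GR, v ∈ G.winningSet p}

/-! ## A random access machine with natural and real cells

Programs are structured. They work on finitely many arrays (named in the program text by
numerals) of natural numbers and of real numbers. Every array is infinite and is zero outside the
input. On natural numbers there are addition and truncated subtraction, on real numbers the
four field operations (division by zero gives zero) and comparison; every operation and every
array access has unit cost. Real numbers cannot be turned into natural numbers. -/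

/-- The contents of the memory: cell `i` of array `a` is `s.nat a i`, or `s.real a i`. -/
@[ext] structure Store where
  nat : ℕ → ℕ → ℕ
  real : ℕ → ℕ → ℝ

/-- Expressions for natural numbers. -/
inductive NExp where
  | lit (c : ℕ)
  | get (a : ℕ) (i : NExp)
  | add (e f : NExp)
  | sub (e f : NExp)

/-- The value of an expression. -/
def NExp.eval (s : Store) : NExp → ℕ
  | lit c => c
  | get a i => s.nat a (i.eval s)
  | add e f => e.eval s + f.eval s
  | sub e f => e.eval s - f.eval s

/-- The number of operations in an expression. -/
def NExp.cost : NExp → ℕ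
  | lit _ => 1
  | get _ i => 1 + i.cost
  | add e f => 1 + e.cost + f.cost
  | sub e f => 1 + e.cost + f.cost

/-- Expressions for real numbers. -/
inductive RExp where
  | zero
  | one
  | get (a : ℕ) (i : NExp)
  | add (e f : RExp)
  | sub (e f : RExp)
  | mul (e f : RExp)
  | div (e f : RExp)

/-- The value of an expression. -/
noncomputable def RExp.eval (s : Store) : RExp → ℝ
  | zero => 0
  | one => 1
  | get a i => s.real a (i.eval s)
  | add e f => e.eval s + f.eval s
  | sub e f => e.eval s - f.eval s
  | mul e f => e.eval s * f.eval s
  | div e f => e.eval s / f.eval s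

/-- The number of operations in an expression. -/
def RExp.cost : RExp → ℕ
  | zero => 1
  | one => 1
  | get _ i => 1 + i.cost
  | add e f => 1 + e.cost + f.cost
  | sub e f => 1 + e.cost + f.cost
  | mul e f => 1 + e.cost + f.cost
  | div e f => 1 + e.cost + f.cost

/-- Conditions. -/
inductive BExp where
  | natEq (e f : NExp)
  | natLt (e f : NExp)
  | realLt (e f : RExp)
  | not (b : BExp)
  | and (b c : BExp)

/-- Truth of a condition. -/
def BExp.Holds (s : Store) : BExp → Prop
  | natEq e f => e.eval s = f.eval s
  | natLt e f => e.eval s < f.eval s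
  | realLt e f => e.eval s < f.eval s
  | not b => ¬ b.Holds s
  | and b c => b.Holds s ∧ c.Holds s

/-- The number of operations in a condition. -/
def BExp.cost : BExp → ℕ
  | natEq e f => 1 + e.cost + f.cost
  | natLt e f => 1 + e.cost + f.cost
  | realLt e f => 1 + e.cost + f.cost
  | not b => 1 + b.cost
  | and b c => 1 + b.cost + c.cost

/-- Programs. `nset a i e` and `rset a i e` assign the value of `e` to cell `i` of array `a`.
`call p ns rs nout rout` runs the program `p` as a subroutine in a memory of its own, see
`Exec.call`. -/
inductive Prog where
  | skip
  | nset (a : ℕ) (i e : NExp)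
  | rset (a : ℕ) (i : NExp) (e : RExp)
  | seq (p q : Prog)
  | ite (b : BExp) (p q : Prog)
  | loop (b : BExp) (p : Prog)
  | call (p : Prog) (ns rs : List (ℕ × NExp)) (nout rout : ℕ × NExp)

/-- An input: the initial contents of the natural arrays `0, 1, …` and of the real arrays
`0, 1, …`. -/
structure Input where
  nats : List (List ℕ)
  reals : List (List ℝ)

/-- The number of cells of an input. -/
def Input.size (x : Input) : ℕ :=
  (x.nats.map List.length).sum + (x.reals.map List.length).sum

/-- The memory that holds the input and is zero elsewhere. -/
def Input.load (x : Input) : Store where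
  nat a i := (x.nats.getD a []).getD i 0
  real a i := (x.reals.getD a []).getD i 0

/-- Assign to cell `i` of the natural array `a`. -/
def Store.setNat (s : Store) (a i x : ℕ) : Store where
  nat := Function.update s.nat a (Function.update (s.nat a) i x)
  real := s.real

/-- Assign to cell `i` of the real array `a`. -/
def Store.setReal (s : Store) (a i : ℕ) (x : ℝ) : Store where
  nat := s.nat
  real := Function.update s.real a (Function.update (s.real a) i x)

/-- The input handed to a subroutine: of each listed array, the first cells, as many as the
accompanying expression says. -/
def Store.args (s : Store) (ns rs : List (ℕ × NExp)) : Input where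
  nats := ns.map fun x => (List.range (x.2.eval s)).map (s.nat x.1)
  reals := rs.map fun x => (List.range (x.2.eval s)).map (s.real x.1)

/-- The return from a subroutine whose final memory is `t` to the caller's memory `s`: the first
`nl` cells of the natural array `0` of `t` are copied to the natural array `na` of `s`, the first
`rl` cells of the real array `0` of `t` to the real array `ra` of `s`. -/
def Store.ret (s t : Store) (na nl ra rl : ℕ) : Store where
  nat a i := if a = na ∧ i < nl then t.nat 0 i else s.nat a i
  real a i := if a = ra ∧ i < rl then t.real 0 i else s.real a i

/-- `Exec p s t s'`: started in the memory `s`, the program `p` halts after `t` steps in the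
memory `s'`. A subroutine call copies the arguments and the results cell by cell. -/
inductive Exec : Prog → Store → ℕ → Store → Prop where
  | skip (s : Store) : Exec Prog.skip s 1 s
  | nset (s : Store) (a : ℕ) (i e : NExp) :
      Exec (Prog.nset a i e) s (1 + i.cost + e.cost) (s.setNat a (i.eval s) (e.eval s))
  | rset (s : Store) (a : ℕ) (i : NExp) (e : RExp) :
      Exec (Prog.rset a i e) s (1 + i.cost + e.cost) (s.setReal a (i.eval s) (e.eval s))
  | seq {p q : Prog} {s₀ s₁ s₂ : Store} {t₁ t₂ : ℕ} :
      Exec p s₀ t₁ s₁ → Exec q s₁ t₂ s₂ → Exec (Prog.seq p q) s₀ (t₁ + t₂) s₂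
  | ite_true {b : BExp} {p q : Prog} {s s' : Store} {t : ℕ} :
      b.Holds s → Exec p s t s' → Exec (Prog.ite b p q) s (1 + b.cost + t) s'
  | ite_false {b : BExp} {p q : Prog} {s s' : Store} {t : ℕ} :
      ¬ b.Holds s → Exec q s t s' → Exec (Prog.ite b p q) s (1 + b.cost + t) s'
  | loop_done {b : BExp} {p : Prog} {s : Store} :
      ¬ b.Holds s → Exec (Prog.loop b p) s (1 + b.cost) s
  | loop_step {b : BExp} {p : Prog} {s₀ s₁ s₂ : Store} {t₁ t₂ : ℕ} :
      b.Holds s₀ → Exec p s₀ t₁ s₁ → Exec (Prog.loop b p) s₁ t₂ s₂ →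
      Exec (Prog.loop b p) s₀ (1 + b.cost + t₁ + t₂) s₂
  | call {p : Prog} {ns rs : List (ℕ × NExp)} {nout rout : ℕ × NExp} {s s' : Store} {t : ℕ} :
      Exec p (s.args ns rs).load t s' →
      Exec (Prog.call p ns rs nout rout) s
        (1 + (ns.map fun x => x.2.cost).sum + (rs.map fun x => x.2.cost).sum
          + nout.2.cost + rout.2.cost
          + (s.args ns rs).size + t + nout.2.eval s + rout.2.eval s)
        (s.ret s' nout.1 (nout.2.eval s) rout.1 (rout.2.eval s))

/-- On the input `x`, the program `p` halts in time at most `T` with a memory that satisfies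
`Q`. Reading the input is charged with one step for each of its cells. -/
def Prog.RunsIn (p : Prog) (x : Input) (T : ℕ) (Q : Store → Prop) : Prop :=
  ∃ t s, Exec p x.load t s ∧ x.size + t ≤ T ∧ Q s

/-! ## The three computational problems -/

open Classical in
/-- The characteristic vector of a set of vertices. -/
noncomputable def bits {n : ℕ} (S : Set (Fin n)) : List ℕ :=
  List.ofFn fun v => if v ∈ S then 1 else 0

/-- `es` lists every edge of `G` exactly once. -/
def MDPGraph.IsEdgeList {V : Type*} (G : MDPGraph V) (es : List (V × V)) : Prop :=
  es.Nodup ∧ ∀ u v, (u, v) ∈ es ↔ G.E u v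

/-- An MDP graph as an input: natural arrays `[n, m]`, the characteristic vector of the
probabilistic vertices, the sources of the edges, the targets of the edges. -/
noncomputable def MDPGraph.encode {n : ℕ} (G : MDPGraph (Fin n)) (es : List (Fin n × Fin n)) :
    Input where
  nats := [[n, es.length], bits G.VP, es.map fun e => (e.1 : ℕ), es.map fun e => (e.2 : ℕ)]
  reals := []

/-- `lab` describes the decomposition into maximal end-components: it is zero outside of them,
and equal nonzero labels mean the same component. -/
def MDPGraph.IsMECLabelling {V : Type*} (G : MDPGraph V) (lab : V → ℕ) : Prop :=
  (∀ v, lab v ≠ 0 ↔ ∃ C, G.IsMEC C ∧ v ∈ C) ∧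
  ∀ u v, lab u ≠ 0 → lab v ≠ 0 → (lab u = lab v ↔ ∃ C, G.IsMEC C ∧ u ∈ C ∧ v ∈ C)

/-- `T n m` is an upper bound for the complexity of computing the decomposition into maximal
end-components: some program does it within time `T n m` for all MDP graphs with at most `n`
vertices and at most `m` edges. -/
def MECSolvableIn (T : ℕ → ℕ → ℕ) : Prop :=
  ∃ p : Prog, ∀ (n m n' : ℕ) (G : MDPGraph (Fin n')) (es : List (Fin n' × Fin n')),
    G.IsEdgeList es → n' ≤ n → es.length ≤ m →
      p.RunsIn (G.encode es) (T n m) fun s => G.IsMECLabelling fun v => s.nat 0 v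

/-- A linear program with `m` constraints over `n` nonnegative variables:
minimize `c ⬝ x` subject to `b ≤ A x` and `0 ≤ x`. -/
structure LinProg (n m : ℕ) where
  A : Matrix (Fin m) (Fin n) ℝ
  b : Fin m → ℝ
  c : Fin n → ℝ

/-- Feasible points. -/
def LinProg.Feasible {n m : ℕ} (L : LinProg n m) (x : Fin n → ℝ) : Prop :=
  0 ≤ x ∧ L.b ≤ L.A.mulVec x

/-- Optimal solutions. -/
def LinProg.IsOptimal {n m : ℕ} (L : LinProg n m) (x : Fin n → ℝ) : Prop :=
  L.Feasible x ∧ ∀ y, L.Feasible y → L.c ⬝ᵥ x ≤ L.c ⬝ᵥ y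

/-- A linear program as an input: natural array `[n, m]`, real arrays `A` (row by row), `b`
and `c`. -/
def LinProg.encode {n m : ℕ} (L : LinProg n m) : Input where
  nats := [[n, m]]
  reals := [(List.ofFn fun i => List.ofFn (L.A i)).flatten, List.ofFn L.b, List.ofFn L.c]

/-- `T n m` is an upper bound for the complexity of linear programming with `m` constraints over
`n` variables: some program finds, within time `T n m`, an optimal solution of every linear
program with at most `m` constraints over at most `n` variables that has one. -/
def LPSolvableIn (T : ℕ → ℕ → ℕ) : Prop :=
  ∃ p : Prog, ∀ (n m n' m' : ℕ) (L : LinProg n' m'),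
    (∃ x, L.IsOptimal x) → n' ≤ n → m' ≤ m →
      p.RunsIn L.encode (T n m) fun s => L.IsOptimal fun v => s.real 0 v

open Classical in
/-- The probability on an edge (zero for an edge of player 0). -/
noncomputable def MDP.prob {V : Type*} (M : MDP V) (e : V × V) : ℝ :=
  if h : e.1 ∈ M.VP then (M.δ ⟨e.1, h⟩ e.2).toReal else 0

/-- `ℓ_1 + … + ℓ_k`. -/
def sumLen {V : Type*} (GR : List (GRPair V)) : ℕ := (GR.map fun p => p.I.length).sum

/-- An MDP with generalized Rabin pairs as an input: natural arrays `[n, m, k]`, the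
characteristic vector of the probabilistic vertices, the sources and the targets of the edges, the
numbers `ℓ_i`, the characteristic vectors of the `F_i`, those of the `I_i^j`; real array: the
probabilities on the edges. -/
noncomputable def MDP.encode {n : ℕ} (M : MDP (Fin n)) (es : List (Fin n × Fin n))
    (GR : List (GRPair (Fin n))) : Input where
  nats := [[n, es.length, GR.length], bits M.VP,
    es.map fun e => (e.1 : ℕ), es.map fun e => (e.2 : ℕ),
    GR.map fun p => p.I.length,
    (GR.map fun p => bits p.F).flatten,
    (GR.map fun p => (p.I.map bits).flatten).flatten]
  reals := [es.map M.prob]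

/-- Some program computes, for every MDP with `n` vertices, `m` edges and `k` generalized Rabin
pairs with `ℓ_1 + … + ℓ_k = l`, the optimal value at every vertex, within time `T n m k l`. -/
def GRPSolvableIn (T : ℕ → ℕ → ℕ → ℕ → ℕ) : Prop :=
  ∃ p : Prog, ∀ (n : ℕ) (M : MDP (Fin n)) (es : List (Fin n × Fin n))
    (GR : List (GRPair (Fin n))), M.IsEdgeList es →
      p.RunsIn (M.encode es GR) (T n es.length GR.length (sumLen GR)) fun s =>
        ∀ v : Fin n, s.real 0 v = (M.value (accepted GR) v).toReal

end GRPModel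

/-! Values. Under any strategy the limit set of a play is almost surely an end-component: a move
whose probability is bounded below occurs infinitely often as soon as its source does
(`MDP.law_infSet_step`). If a pair accepts, this end-component avoids its `F`, so it lies in a
maximal end-component avoiding `F`, which then meets every set of `I`. Thus acceptance almost surely
implies a visit to `M.winning GR` (`MDP.law_accepted_le`), and the probability of that visit is at
most `MDP.reachValue`, the least fixed point of the Bellman operator (`MDP.law_reach_le`).

Conversely one memoryless strategy attains this bound and is accepted almost surely once the target
is reached (`MDP.exists_strategy_accepted`). Outside the target it moves uniformly along
value-preserving edges; this suffices because minimality of the fixed point yields a path of such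
edges to the target from every vertex of positive value (`MDP.exists_path_of_reachValue_pos`).
Inside, it moves uniformly within a winning component of the first pair for which the current vertex
wins. Components of different pairs may overlap, but the index of that first pair never increases
along the play, so the component is eventually constant and is covered entirely
(`infSet_eq_of_ranked`).

Complexity. `MDP.reachValue` is the least feasible point of a linear program with one constraint per
edge, hence its only optimum (`MDP.eq_reachValue_of_isOptimal`). The winning set of one pair comes
from one decomposition of the graph in which the vertices of `F` keep only a self-loop
(`MDPGraph.mem_winningSet_iff`), followed by a linear pass over the labels for each set of `I`. The
overhead is absorbed because reading is charged: a decomposition costs at least its `n + 2m` input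
cells and a linear program at least its `nm` matrix entries. Correctness and running time of each
program are proved together through `Prog.wp`. -/

set_option linter.unusedSectionVars false

namespace GRPModel

/-! ### The law of a play: one-step disintegration and fairness. -/

section Plays

variable {V : Type*} [Fintype V] [MeasurableSpace V] [MeasurableSingletonClass V]

/-- One-step disintegration of the law of the play. -/
theorem MDP.lintegral_law_step (M : MDP V) (σ : M.Strategy) (v : V) (t : ℕ)
    (g : (Finset.Iic t → V) → V → ℝ≥0∞) :
    ∫⁻ ρ, g (fun i => ρ i) (ρ (t + 1)) ∂M.law σ v =
      ∫⁻ ρ, ∑ u, M.next σ t (fun i => ρ i) u * g (fun i => ρ i) u ∂M.law σ v := by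
  have hm : ∀ f : (Finset.Iic t → V) × V → ℝ≥0∞, Measurable f := fun f => measurable_of_countable f
  -- The history up to `t` together with the next vertex is distributed as the composition-product
  -- of the history law with the kernel.
  have h1 := Kernel.partialTraj_compProd_eq_map_traj (X := fun _ => V) (κ := M.kernel σ)
    (Nat.zero_le t) (x₀ := fun _ => v)
  have h2 := lintegral_map (μ := M.law σ v) (hm (fun p => g p.1 p.2))
    (g := fun x => (Preorder.frestrictLe t x, x (t + 1))) (by fun_prop)
  have h3 : ∫⁻ ρ, g (fun i => ρ i) (ρ (t + 1)) ∂M.law σ v =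
      ∫⁻ p, g p.1 p.2 ∂((M.law σ v).map fun x => (Preorder.frestrictLe t x, x (t + 1))) := by
    rw [h2]; rfl
  rw [h3, MDP.law, ← h1, Measure.lintegral_compProd (hm _), ← Kernel.traj_map_frestrictLe_apply,
    lintegral_map (measurable_of_countable _) (by fun_prop)]
  refine lintegral_congr fun ρ => ?_
  rw [lintegral_fintype]
  refine Finset.sum_congr rfl fun u _ => ?_
  rw [mul_comm]
  congr 1
  simp only [MDP.kernel, Kernel.ofFunOfCountable, Kernel.coe_mk]
  exact PMF.toMeasure_apply_singleton _ _ (measurableSet_singleton _)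

instance (M : MDP V) (σ : M.Strategy) (v : V) : IsProbabilityMeasure (M.law σ v) := by
  unfold MDP.law; infer_instance

theorem MDP.law_start (M : MDP V) (σ : M.Strategy) (v : V) : ∀ᵐ ρ ∂M.law σ v, ρ 0 = v := by
  have h := Kernel.traj_map_frestrictLe_apply (X := fun _ => V) (κ := M.kernel σ) 0 0 (fun _ => v)
  rw [Kernel.partialTraj_self, Kernel.id_apply] at h
  have h2 : ∀ᵐ x ∂((M.law σ v).map (Preorder.frestrictLe (π := fun _ => V) 0)),
      x ⟨0, by simp⟩ = v := by
    rw [MDP.law, h]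
    exact (ae_dirac_iff (MeasurableSet.of_discrete)).2 rfl
  exact ae_of_ae_map (by fun_prop) h2

theorem measurable_play_dep (t : ℕ) (g : (Finset.Iic t → V) → ℝ≥0∞) :
    Measurable fun ρ : ℕ → V => g fun i => ρ i :=
  (measurable_of_countable g).comp (by fun_prop)

theorem measurable_play_dep' (t : ℕ) (g : (Finset.Iic t → V) → V → ℝ≥0∞) :
    Measurable fun ρ : ℕ → V => g (fun i => ρ i) (ρ (t + 1)) :=
  (measurable_of_countable fun p : (Finset.Iic t → V) × V => g p.1 p.2).comp
    (f := fun ρ : ℕ → V => (fun i : Finset.Iic t => ρ i, ρ (t + 1))) (by fun_prop)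

/-- Almost every play only makes moves of positive probability. -/
theorem MDP.law_support (M : MDP V) (σ : M.Strategy) (v : V) :
    ∀ᵐ ρ ∂M.law σ v, ∀ t, M.next σ t (fun i => ρ i) (ρ (t + 1)) ≠ 0 := by
  classical
  rw [ae_all_iff]
  intro t
  have h := M.lintegral_law_step σ v t fun h u => if M.next σ t h u = 0 then 1 else 0
  simp only [mul_ite, mul_one, mul_zero] at h
  have h0 : ∀ ρ : ℕ → V, ∑ u, (if M.next σ t (fun i => ρ i) u = 0 then
      M.next σ t (fun i => ρ i) u else 0) = 0 := fun ρ => by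
    refine Finset.sum_eq_zero fun u _ => ?_
    split_ifs with hu
    · exact hu
    · rfl
  simp only [h0, lintegral_zero] at h
  rw [lintegral_eq_zero_iff (measurable_play_dep' t
    fun h u => if M.next σ t h u = 0 then 1 else 0)] at h
  filter_upwards [h] with ρ hρ hc
  simp [hc] at hρ

/-- If in `v` the move to `u` always has probability at least `p > 0`, then almost every play that
visits `v` infinitely often also visits `u` infinitely often. -/
theorem MDP.law_infSet_step (M : MDP V) (σ : M.Strategy) (v₀ v u : V) (p : ℝ≥0∞) (hp : 0 < p)
    (hnext : ∀ t (h : Finset.Iic t → V), h ⟨t, Finset.mem_Iic.2 le_rfl⟩ = v →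
      p ≤ M.next σ t h u) :
    ∀ᵐ ρ ∂M.law σ v₀, v ∈ infSet ρ → u ∈ infSet ρ := by
  classical
  -- Lowering `p` below one keeps `1 - r` nonzero, so that `(1 - r) * q = 1` for `q = (1 - r)⁻¹`.
  obtain ⟨r, hr0, hrp, hr1⟩ : ∃ r : ℝ≥0∞, 0 < r ∧ r ≤ p ∧ r < 1 := by
    refine ⟨min p 2⁻¹, lt_min hp (by simp), min_le_left _ _, lt_of_le_of_lt (min_le_right _ _) ?_⟩
    norm_num
  set q : ℝ≥0∞ := (1 - r)⁻¹ with hq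
  have hr1' : 1 - r ≠ 0 := (tsub_pos_of_lt hr1).ne'
  have hrt : 1 - r ≠ ∞ := ENNReal.sub_ne_top ENNReal.one_ne_top
  have hq1 : 1 < q := by
    rw [hq, ENNReal.one_lt_inv]
    exact ENNReal.sub_lt_self ENNReal.one_ne_top one_ne_zero hr0.ne'
  -- Bet against `u` from time `N` on: the capital `F` is multiplied by `q` whenever `v` is left for
  -- a vertex other than `u`, and is lost when `u` is entered. The expected factor is at most one,
  -- so `F` is a supermartingale.
  have key : ∀ N : ℕ, ∀ᵐ ρ ∂M.law σ v₀, ¬ (v ∈ infSet ρ ∧ ∀ i, N ≤ i → ρ (i + 1) ≠ u) := by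
    intro N
    let c : ℕ → V → V → ℝ≥0∞ := fun i a b =>
      if i < N then 1 else if b = u then 0 else if a = v then q else 1
    let F : ℕ → (ℕ → V) → ℝ≥0∞ := fun t ρ => ∏ i ∈ Finset.range t, c i (ρ i) (ρ (i + 1))
    have hmeas : ∀ t, Measurable (F t) := fun t =>
      Finset.measurable_prod _ fun i _ =>
        (measurable_of_countable fun p : V × V => c i p.1 p.2).comp
          (f := fun ρ : ℕ → V => (ρ i, ρ (i + 1))) (by fun_prop)
    have hF : ∀ t, ∫⁻ ρ, F t ρ ∂M.law σ v₀ ≤ 1 := by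
      intro t
      induction t with
      | zero => simp [F]
      | succ t ih =>
        refine le_trans ?_ ih
        let F' : (Finset.Iic t → V) → ℝ≥0∞ := fun h => ∏ i : Fin t,
          c i (h ⟨i, Finset.mem_Iic.2 i.2.le⟩) (h ⟨i + 1, Finset.mem_Iic.2 i.2⟩)
        have hF' : ∀ ρ : ℕ → V, F t ρ = F' fun i => ρ i := fun ρ => by
          simp only [F, F', Finset.prod_range]
        have h := M.lintegral_law_step σ v₀ t fun h w =>
          F' h * c t (h ⟨t, Finset.mem_Iic.2 le_rfl⟩) w
        have h1 : ∀ ρ, F (t + 1) ρ = F' (fun i => ρ i) * c t (ρ t) (ρ (t + 1)) := fun ρ => by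
          rw [← hF']; simp only [F, Finset.prod_range_succ]
        simp only [h1, hF']
        refine h.le.trans (lintegral_mono fun ρ => ?_)
        have hsum : ∑ w, M.next σ t (fun i => ρ i) w = 1 := by
          rw [← tsum_fintype (L := .unconditional _)]; exact PMF.tsum_coe _
        have : ∑ w, M.next σ t (fun i => ρ i) w * c t (ρ t) w ≤ 1 := by
          by_cases htN : t < N
          · simp [c, htN, hsum]
          by_cases hv : ρ t = v
          · have hle := hnext t (fun i => ρ i) hv
            have : ∀ w, M.next σ t (fun i => ρ i) w * c t (ρ t) w =
                if w = u then 0 else M.next σ t (fun i => ρ i) w * q := fun w => by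
              by_cases hw : w = u <;> simp [c, htN, hv, hw]
            simp only [this]
            rw [← Finset.add_sum_erase _ _ (Finset.mem_univ u)] at hsum
            rw [← Finset.add_sum_erase _ _ (Finset.mem_univ u), if_pos rfl, zero_add,
              Finset.sum_congr rfl fun w hw => if_neg (Finset.ne_of_mem_erase hw),
              ← Finset.sum_mul]
            calc _ ≤ (1 - r) * q := by
                  refine mul_le_mul_left ?_ q
                  refine ENNReal.le_sub_of_add_le_left (ne_top_of_lt hr1) ?_
                  rw [← hsum]
                  exact add_le_add_left (hrp.trans hle) _
              _ = 1 := ENNReal.mul_inv_cancel hr1' hrt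
          · refine le_trans (Finset.sum_le_sum fun w _ => ?_) hsum.le
            refine (mul_le_mul_right ?_ _).trans (mul_one _).le
            simp only [c, htN, hv, if_false]
            split_ifs <;> simp
        calc _ = F' (fun i => ρ i) * ∑ w, M.next σ t (fun i => ρ i) w * c t (ρ t) w := by
              rw [Finset.mul_sum]; exact Finset.sum_congr rfl fun w _ => by ring
          _ ≤ F' (fun i => ρ i) * 1 := mul_le_mul_right this _
          _ = _ := mul_one _
    -- By Fatou the lower limit of the capital is almost surely finite, whereas on the bad event it
    -- is infinite, each visit to `v` contributing a factor `q > 1`.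
    have hfat : ∫⁻ ρ, Filter.liminf (fun t => F t ρ) Filter.atTop ∂M.law σ v₀ ≠ ∞ := by
      refine ne_top_of_le_ne_top ENNReal.one_ne_top ((lintegral_liminf_le hmeas).trans ?_)
      exact Filter.liminf_le_of_frequently_le' (Filter.Frequently.of_forall hF)
    filter_upwards [ae_lt_top (Measurable.liminf hmeas) hfat] with ρ hρ ⟨hv, hu⟩
    refine hρ.ne ?_
    have hc1 : ∀ i, 1 ≤ c i (ρ i) (ρ (i + 1)) := fun i => by
      simp only [c]
      by_cases hi : i < N
      · simp [hi]
      · rw [if_neg hi, if_neg (hu i (not_lt.1 hi))]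
        split_ifs
        · exact hq1.le
        · exact le_rfl
    have hmono : Monotone fun t => F t ρ := monotone_nat_of_le_succ fun t => by
      simp only [F, Finset.prod_range_succ]
      exact le_mul_of_one_le_right' (hc1 t)
    have hpow : ∀ m, ∃ t, q ^ m ≤ F t ρ := by
      intro m
      induction m with
      | zero => exact ⟨0, by simp [F]⟩
      | succ m ih =>
        obtain ⟨t, ht⟩ := ih
        obtain ⟨i, hi, hiv⟩ := (Filter.frequently_atTop.1 hv) (max t N)
        refine ⟨i + 1, ?_⟩
        simp only [F, Finset.prod_range_succ, pow_succ]
        refine mul_le_mul' (ht.trans (hmono ((le_max_left _ _).trans hi))) ?_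
        have hNi : N ≤ i := (le_max_right _ _).trans hi
        simp [c, not_lt.2 hNi, hu i hNi, hiv]
    rw [(tendsto_atTop_iSup hmono).liminf_eq, eq_top_iff]
    refine le_of_tendsto' (ENNReal.tendsto_pow_atTop_nhds_top_iff.2 hq1) fun m => ?_
    obtain ⟨t, ht⟩ := hpow m
    exact ht.trans (le_iSup (fun t => F t ρ) t)
  filter_upwards [ae_all_iff.2 key] with ρ hρ hv
  by_contra hu
  rw [infSet, Set.mem_ofPred_eq, Filter.not_frequently, Filter.eventually_atTop] at hu
  obtain ⟨N, hN⟩ := hu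
  exact hρ N ⟨hv, fun i hi => hN (i + 1) (by omega)⟩

end Plays

/-! ### The reachability value as a least fixed point. -/

section ReachValue

variable {V : Type*} [Fintype V]

open Classical in
/-- The Bellman operator of the objective to reach `W`. -/
noncomputable def MDP.bellman (M : MDP V) (W : Set V) : (V → ℝ≥0∞) →o (V → ℝ≥0∞) where
  toFun x v := if v ∈ W then 1 else
    if h : v ∈ M.VP then ∑ u, M.δ ⟨v, h⟩ u * x u else ⨆ u : {u // M.E v u}, x u
  monotone' x y hxy v := by
    dsimp only
    split_ifs
    · exact le_rfl
    · exact Finset.sum_le_sum fun u _ => mul_le_mul_right (hxy u) _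
    · exact iSup_mono fun u => hxy u

open Classical in
theorem MDP.bellman_apply (M : MDP V) (W : Set V) (x : V → ℝ≥0∞) (v : V) :
    M.bellman W x v = if v ∈ W then 1 else
      if h : v ∈ M.VP then ∑ u, M.δ ⟨v, h⟩ u * x u else ⨆ u : {u // M.E v u}, x u := rfl

/-- The least fixed point of the Bellman operator. -/
noncomputable def MDP.reachValue (M : MDP V) (W : Set V) : V → ℝ≥0∞ := (M.bellman W).lfp

variable (M : MDP V) (W : Set V)

theorem MDP.bellman_reachValue : M.bellman W (M.reachValue W) = M.reachValue W :=
  OrderHom.map_lfp _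

theorem MDP.reachValue_le {x : V → ℝ≥0∞} (hx : M.bellman W x ≤ x) : M.reachValue W ≤ x :=
  OrderHom.lfp_le _ hx

theorem MDP.reachValue_of_mem {v : V} (hv : v ∈ W) : M.reachValue W v = 1 := by
  rw [← M.bellman_reachValue W]; simp [bellman_apply, hv]

theorem MDP.reachValue_prob {v : V} (hv : v ∉ W) (h : v ∈ M.VP) :
    M.reachValue W v = ∑ u, M.δ ⟨v, h⟩ u * M.reachValue W u := by
  conv_lhs => rw [← M.bellman_reachValue W]
  simp [bellman_apply, hv, h]

theorem MDP.reachValue_player {v : V} (hv : v ∉ W) (h : v ∉ M.VP) :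
    M.reachValue W v = ⨆ u : {u // M.E v u}, M.reachValue W u := by
  conv_lhs => rw [← M.bellman_reachValue W]
  simp [bellman_apply, hv, h]

theorem PMF.sum_univ_eq_one (p : PMF V) : ∑ u, p u = 1 := by
  rw [← tsum_fintype (L := .unconditional _)]; exact PMF.tsum_coe _

theorem MDP.reachValue_le_one (v : V) : M.reachValue W v ≤ 1 := by
  refine M.reachValue_le W (x := fun _ => 1) (fun v => ?_) v
  rw [bellman_apply]
  split_ifs
  · exact le_rfl
  · simp [PMF.sum_univ_eq_one]
  · exact iSup_le fun _ => le_rfl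

theorem MDP.reachValue_le_of_edge {v u : V} (hv : v ∉ W) (h : v ∉ M.VP) (e : M.E v u) :
    M.reachValue W u ≤ M.reachValue W v := by
  rw [M.reachValue_player W hv h]
  exact le_iSup (fun u : {u // M.E v u} => M.reachValue W u) ⟨u, e⟩

theorem MDP.exists_optimal_edge {v : V} (hv : v ∉ W) (h : v ∉ M.VP) :
    ∃ u, M.E v u ∧ M.reachValue W u = M.reachValue W v := by
  obtain ⟨u₀, hu₀⟩ := M.total v
  have : Nonempty {u // M.E v u} := ⟨⟨u₀, hu₀⟩⟩
  obtain ⟨u, hu⟩ := exists_eq_ciSup_of_finite (f := fun u : {u // M.E v u} => M.reachValue W u)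
  exact ⟨u, u.2, by rw [hu, M.reachValue_player W hv h]⟩

/-- The edges that lose no value. -/
def MDP.OptEdge (v u : V) : Prop := M.E v u ∧ (v ∉ M.VP → M.reachValue W u = M.reachValue W v)

/-- A vertex from which `W` cannot be reached along optimal edges has value zero. -/
theorem MDP.exists_path_of_reachValue_pos {v : V} (hv : M.reachValue W v ≠ 0) :
    ∃ w ∈ W, Relation.ReflTransGen (fun a b => a ∉ W ∧ M.OptEdge W a b) v w := by
  classical
  set x := M.reachValue W with hx
  have hfin : ∀ v, x v ≠ ∞ := fun v => ne_top_of_le_ne_top ENNReal.one_ne_top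
    (M.reachValue_le_one W v)
  -- `lam` is the largest ratio of two distinct values, smaller over larger. It is below one by
  -- finiteness, also when `P` is empty, where the supremum is zero.
  let P : Finset (V × V) := Finset.univ.filter fun p => x p.1 < x p.2
  let lam : ℝ≥0∞ := P.sup fun p => x p.1 / x p.2
  have hlam : lam < 1 := by
    rw [Finset.sup_lt_iff (by simp)]
    intro p hp
    have hp' : x p.1 < x p.2 := (Finset.mem_filter.1 hp).2
    exact ENNReal.div_lt_of_lt_mul (by simpa using hp')
  have hlt : ∀ a b, x a < x b → x a ≤ lam * x b := fun a b hab => by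
    rw [← ENNReal.div_le_iff (pos_of_gt hab).ne' (hfin b)]
    exact Finset.le_sup (f := fun p : V × V => x p.1 / x p.2) (b := (a, b)) (by simp [P, hab])
  let S : Set V := {v | ¬ ∃ w ∈ W, Relation.ReflTransGen
    (fun a b => a ∉ W ∧ M.OptEdge W a b) v w}
  have hSW : ∀ a ∈ S, a ∉ W := fun a ha haW => ha ⟨a, haW, .refl⟩
  have hSstep : ∀ a ∈ S, ∀ b, M.OptEdge W a b → b ∈ S := fun a ha b hab ⟨w, hw, hp⟩ =>
    ha ⟨w, hw, .head ⟨hSW a ha, hab⟩ hp⟩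
  -- Shrinking `x` by `lam` on `S` leaves a pre-fixed point: optimal edges from `S` stay in `S`, and
  -- every other edge already loses the factor `lam`. Minimality then gives `x ≤ lam * x` on `S`, so
  -- `x` vanishes there.
  let y : V → ℝ≥0∞ := fun v => if v ∈ S then lam * x v else x v
  have hyx : y ≤ x := fun v => by
    by_cases h : v ∈ S
    · simp only [y, h, if_true]
      exact mul_le_of_le_one_left' hlam.le
    · simp [y, h]
  have hyS : ∀ b ∈ S, y b = lam * x b := fun b hb => by simp [y, hb]
  have hy : M.bellman W y ≤ y := fun v => by
    by_cases h : v ∈ S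
    · rw [hyS v h]
      have hvW := hSW v h
      by_cases hp : v ∈ M.VP
      · rw [hx, M.reachValue_prob W hvW hp, Finset.mul_sum]
        simp only [bellman_apply, hvW, hp, if_false, dif_pos]
        refine Finset.sum_le_sum fun u _ => ?_
        by_cases hu : M.δ ⟨v, hp⟩ u = 0
        · simp [hu]
        · have he : M.E v u := (M.edge_iff ⟨v, hp⟩ u).2 (pos_iff_ne_zero.2 hu)
          rw [hyS u (hSstep v h u ⟨he, fun h => absurd hp h⟩)]
          exact le_of_eq (by ring)
      · simp only [bellman_apply, hvW, hp, if_false, dif_neg, not_false_eq_true]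
        refine iSup_le fun ⟨u, hu⟩ => ?_
        rcases (M.reachValue_le_of_edge W hvW hp hu).lt_or_eq with h1 | h1
        · exact (hyx u).trans (hlt _ _ h1)
        · rw [hyS u (hSstep v h u ⟨hu, fun _ => h1⟩), hx, h1]
    · calc M.bellman W y v ≤ M.bellman W x v := (M.bellman W).monotone hyx v
        _ = x v := by rw [hx, M.bellman_reachValue]
        _ = y v := by simp [y, h]
  by_contra hS
  have h1 := M.reachValue_le W hy v
  rw [hyS v hS] at h1
  have : lam * x v < 1 * x v := (ENNReal.mul_lt_mul_iff_left hv (hfin v)).2 hlam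
  rw [one_mul] at this
  exact absurd h1 (not_le.2 this)

end ReachValue

/-! ### Martingale bounds for the probability of reaching a set. -/

section Bounds

variable {V : Type*} [Fintype V] [MeasurableSpace V] [MeasurableSingletonClass V]
variable (M : MDP V) (W : Set V)

open Classical in
/-- One if `W` has been visited by time `t`, otherwise the value of the current vertex. -/
noncomputable def MDP.progress (t : ℕ) (h : Finset.Iic t → V) : ℝ≥0∞ :=
  if ∃ i, h i ∈ W then 1 else M.reachValue W (h ⟨t, Finset.mem_Iic.2 le_rfl⟩)

/-- Vertices of `W` have value one, so a first visit at time `t + 1` needs no case of its own. This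
separates the history up to `t` from the next vertex, as `MDP.lintegral_law_step` requires. -/
theorem MDP.progress_succ (t : ℕ) (ρ : ℕ → V) :
    M.progress W (t + 1) (fun i => ρ i) =
      open Classical in
      if ∃ i : Finset.Iic t, ρ i ∈ W then 1 else M.reachValue W (ρ (t + 1)) := by
  unfold progress
  by_cases h : ∃ i : Finset.Iic t, ρ i ∈ W
  · obtain ⟨⟨i, hi⟩, hiW⟩ := h
    have h1 : ∃ i : Finset.Iic t, ρ i ∈ W := ⟨⟨i, hi⟩, hiW⟩
    have h2 : ∃ i : Finset.Iic (t + 1), ρ i ∈ W :=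
      ⟨⟨i, Finset.mem_Iic.2 ((Finset.mem_Iic.1 hi).trans t.le_succ)⟩, hiW⟩
    rw [if_pos h1, if_pos h2]
  · rw [if_neg h]
    split_ifs with h2
    · obtain ⟨⟨i, hi⟩, hiW⟩ := h2
      rcases (Finset.mem_Iic.1 hi).lt_or_eq with h3 | h3
      · exact absurd ⟨⟨i, Finset.mem_Iic.2 (Nat.lt_succ_iff.1 h3)⟩, hiW⟩ h
      · subst h3; exact (M.reachValue_of_mem W hiW).symm
    · rfl

theorem MDP.measurable_progress (t : ℕ) :
    Measurable fun ρ : ℕ → V => M.progress W t fun i => ρ i :=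
  measurable_play_dep t _

theorem MDP.lintegral_progress_zero (σ : M.Strategy) (v : V) :
    ∫⁻ ρ, M.progress W 0 (fun i => ρ i) ∂M.law σ v = M.reachValue W v := by
  have : ∀ᵐ ρ ∂M.law σ v, M.progress W 0 (fun i => ρ i) = M.reachValue W v := by
    filter_upwards [M.law_start σ v] with ρ hρ
    unfold progress
    split_ifs with h
    · obtain ⟨⟨i, hi⟩, hiW⟩ := h
      obtain rfl : i = 0 := by simpa using hi
      rw [← hρ, M.reachValue_of_mem W hiW]
    · simp [hρ]
  rw [lintegral_congr_ae this]; simp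

theorem MDP.lintegral_progress_succ (σ : M.Strategy) (v : V) (t : ℕ) :
    ∫⁻ ρ, M.progress W (t + 1) (fun i => ρ i) ∂M.law σ v =
      open Classical in
      ∫⁻ ρ, (if ∃ i : Finset.Iic t, ρ i ∈ W then 1 else
        ∑ u, M.next σ t (fun i => ρ i) u * M.reachValue W u) ∂M.law σ v := by
  classical
  simp only [M.progress_succ W t]
  rw [M.lintegral_law_step σ v t fun h u => if ∃ i, h i ∈ W then 1 else M.reachValue W u]
  refine lintegral_congr fun ρ => ?_
  by_cases h : ∃ i : Finset.Iic t, ρ i ∈ W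
  · simp only [if_pos h, mul_one, PMF.sum_univ_eq_one]
  · simp only [if_neg h]

theorem MDP.sum_next_reachValue_le (σ : M.Strategy) (t : ℕ) (h : Finset.Iic t → V)
    (hW : h ⟨t, Finset.mem_Iic.2 le_rfl⟩ ∉ W) :
    ∑ u, M.next σ t h u * M.reachValue W u ≤
      M.reachValue W (h ⟨t, Finset.mem_Iic.2 le_rfl⟩) := by
  by_cases hp : h ⟨t, Finset.mem_Iic.2 le_rfl⟩ ∈ M.VP
  · rw [M.reachValue_prob W hW hp]
    simp [MDP.next, hp]
  · simp only [MDP.next, hp, dif_neg, not_false_eq_true]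
    calc _ ≤ ∑ u, σ.choose t h u * M.reachValue W (h ⟨t, Finset.mem_Iic.2 le_rfl⟩) := by
          refine Finset.sum_le_sum fun u _ => ?_
          by_cases hu : σ.choose t h u = 0
          · simp [hu]
          · exact mul_le_mul_right (M.reachValue_le_of_edge W hW hp
              (σ.legal t h u hp (pos_iff_ne_zero.2 hu))) _
      _ = _ := by rw [← Finset.sum_mul, PMF.sum_univ_eq_one, one_mul]

/-- `MDP.progress` is a supermartingale under every strategy: a legal move of player 0 cannot
increase the value, and a probabilistic move preserves it on average. -/
theorem MDP.lintegral_progress_le (σ : M.Strategy) (v : V) (t : ℕ) :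
    ∫⁻ ρ, M.progress W t (fun i => ρ i) ∂M.law σ v ≤ M.reachValue W v := by
  induction t with
  | zero => exact (M.lintegral_progress_zero W σ v).le
  | succ t ih =>
    rw [M.lintegral_progress_succ]
    refine le_trans (lintegral_mono fun ρ => ?_) ih
    unfold progress
    split_ifs with h
    · exact le_rfl
    · exact M.sum_next_reachValue_le W σ t _ fun hW => h ⟨⟨t, Finset.mem_Iic.2 le_rfl⟩, hW⟩

theorem measurableSet_reach : MeasurableSet (reach W : Set (ℕ → V)) := by
  have : (reach W : Set (ℕ → V)) = ⋃ i, (fun ρ : ℕ → V => ρ i) ⁻¹' W := by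
    ext ρ; simp [reach]
  rw [this]
  exact MeasurableSet.iUnion fun i => (measurable_pi_apply i) W.toFinite.measurableSet

/-- The progress is eventually one on plays that visit `W`, so Fatou suffices; nothing need be known
about its limit on the other plays. -/
theorem MDP.law_reach_le (σ : M.Strategy) (v : V) :
    M.law σ v (reach W) ≤ M.reachValue W v := by
  classical
  rw [← lintegral_indicator_one (measurableSet_reach W)]
  calc _ ≤ ∫⁻ ρ, Filter.liminf (fun t => M.progress W t fun i => ρ i) Filter.atTop
        ∂M.law σ v := by
        refine lintegral_mono fun ρ => ?_
        by_cases hρ : ρ ∈ reach W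
        · rw [Set.indicator_of_mem hρ]
          obtain ⟨i, hi⟩ := hρ
          refine Filter.le_liminf_of_le (by isBoundedDefault) ?_
          filter_upwards [Filter.eventually_ge_atTop i] with t ht
          rw [progress, if_pos ⟨⟨i, Finset.mem_Iic.2 ht⟩, hi⟩]
          rfl
        · rw [Set.indicator_of_notMem hρ]; exact zero_le
    _ ≤ Filter.liminf (fun t => ∫⁻ ρ, M.progress W t (fun i => ρ i) ∂M.law σ v) Filter.atTop :=
        lintegral_liminf_le (M.measurable_progress W)
    _ ≤ _ := Filter.liminf_le_of_frequently_le'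
        (Filter.Frequently.of_forall (M.lintegral_progress_le W σ v))

/-- A strategy that loses no value before `W` is reached, and under which the vertices of positive
value are almost surely left for good unless `W` is reached, attains the value. -/
theorem MDP.le_law_reach (τ : M.Strategy) (v : V)
    (hopt : ∀ t (h : Finset.Iic t → V) u, h ⟨t, Finset.mem_Iic.2 le_rfl⟩ ∉ W →
      M.next τ t h u ≠ 0 → M.OptEdge W (h ⟨t, Finset.mem_Iic.2 le_rfl⟩) u)
    (hlim : ∀ᵐ ρ ∂M.law τ v, ρ ∉ reach W → ∀ u ∈ infSet ρ, M.reachValue W u = 0) :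
    M.reachValue W v ≤ M.law τ v (reach W) := by
  classical
  -- Along optimal edges the supermartingale is a martingale.
  have hconst : ∀ t, ∫⁻ ρ, M.progress W t (fun i => ρ i) ∂M.law τ v = M.reachValue W v := by
    intro t
    induction t with
    | zero => exact M.lintegral_progress_zero W τ v
    | succ t ih =>
      rw [M.lintegral_progress_succ, ← ih]
      refine lintegral_congr fun ρ => ?_
      unfold progress
      split_ifs with h
      · rfl
      · have hW : ρ t ∉ W := fun hW => h ⟨⟨t, Finset.mem_Iic.2 le_rfl⟩, hW⟩
        by_cases hp : ρ t ∈ M.VP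
        · simp only
          rw [M.reachValue_prob W hW hp]
          simp [MDP.next, hp]
        · have : ∀ u, M.next τ t (fun i => ρ i) u * M.reachValue W u =
              M.next τ t (fun i => ρ i) u * M.reachValue W (ρ t) := fun u => by
            by_cases hu : M.next τ t (fun i => ρ i) u = 0
            · simp [hu]
            · rw [(hopt t (fun i => ρ i) u hW hu).2 hp]
          simp only [this]
          rw [← Finset.sum_mul, PMF.sum_univ_eq_one, one_mul]
  -- The progress converges to the indicator of `reach W`: a play that misses `W` is eventually
  -- confined to its limit set, where `hlim` makes the value zero.
  have hdom := tendsto_lintegral_of_dominated_convergence (μ := M.law τ v)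
    (F := fun t ρ => M.progress W t fun i => ρ i) (f := (reach W).indicator 1) (fun _ => 1)
    (M.measurable_progress W) (fun t => Filter.Eventually.of_forall fun ρ => by
      simp only [progress]
      split_ifs
      · exact le_rfl
      · exact M.reachValue_le_one W _) (by simp) (by
      filter_upwards [hlim] with ρ hρ
      refine tendsto_const_nhds.congr' ?_
      by_cases hr : ρ ∈ reach W
      · obtain ⟨i, hi⟩ := hr
        filter_upwards [Filter.eventually_ge_atTop i] with t ht
        rw [progress, if_pos ⟨⟨i, Finset.mem_Iic.2 ht⟩, hi⟩,
          Set.indicator_of_mem (show ρ ∈ reach W from ⟨i, hi⟩)]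
        rfl
      · rw [Set.indicator_of_notMem hr]
        have : ∀ u : V, ∀ᶠ t in Filter.atTop, ρ t = u → M.reachValue W u = 0 := fun u => by
          by_cases hu : u ∈ infSet ρ
          · exact Filter.Eventually.of_forall fun t _ => hρ hr u hu
          · have := Filter.not_frequently.1 hu
            filter_upwards [this] with t ht h using absurd h ht
        filter_upwards [Filter.eventually_all.2 this] with t ht
        have hn : ¬ ∃ i : Finset.Iic t, ρ i ∈ W := fun ⟨i, hi⟩ => hr ⟨i, hi⟩
        rw [progress, if_neg hn]
        exact (ht _ rfl).symm)
  rw [lintegral_indicator_one (measurableSet_reach W)] at hdom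
  simp only [hconst] at hdom
  exact (tendsto_nhds_unique tendsto_const_nhds hdom).le

end Bounds

/-! ### Unions of end-components. -/

section EndComponents

variable {V : Type*} {G : MDPGraph V}

theorem MDPGraph.IsEC.union {U U' : Set V} (h : G.IsEC U) (h' : G.IsEC U')
    (hne : (U ∩ U').Nonempty) : G.IsEC (U ∪ U') := by
  obtain ⟨w, hw, hw'⟩ := hne
  have hl : ∀ u ∈ U, ∀ v ∈ U, Relation.TransGen
      (fun a b => a ∈ U ∪ U' ∧ b ∈ U ∪ U' ∧ G.E a b) u v := fun u hu v hv =>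
    Relation.TransGen.mono (fun a b ⟨ha, hb, e⟩ => ⟨.inl ha, .inl hb, e⟩) _ _
      (h.connected u hu v hv)
  have hr : ∀ u ∈ U', ∀ v ∈ U', Relation.TransGen
      (fun a b => a ∈ U ∪ U' ∧ b ∈ U ∪ U' ∧ G.E a b) u v := fun u hu v hv =>
    Relation.TransGen.mono (fun a b ⟨ha, hb, e⟩ => ⟨.inr ha, .inr hb, e⟩) _ _
      (h'.connected u hu v hv)
  refine ⟨h.nonempty.mono Set.subset_union_left, ?_, ?_⟩
  · rintro u (hu | hu) v (hv | hv)
    · exact hl u hu v hv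
    · exact (hl u hu w hw).trans (hr w hw' v hv)
    · exact (hr u hu w hw').trans (hl w hw v hv)
    · exact hr u hu v hv
  · rintro u v e (hu | hu) hp
    · exact .inl (h.closed u v e hu hp)
    · exact .inr (h'.closed u v e hu hp)

/-- Overlapping end-components have an end-component as union, still disjoint from `F`; by
maximality both equal it. -/
theorem MDPGraph.IsMECWithout.eq_of_mem {F C C' : Set V} (h : G.IsMECWithout F C)
    (h' : G.IsMECWithout F C') {v : V} (hv : v ∈ C) (hv' : v ∈ C') : C = C' := by
  have hu : G.IsEC (C ∪ C') ∧ Disjoint (C ∪ C') F :=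
    ⟨h.prop.1.union h'.prop.1 ⟨v, hv, hv'⟩, Set.disjoint_union_left.2 ⟨h.prop.2, h'.prop.2⟩⟩
  exact (h.eq_of_le hu Set.subset_union_left).trans
    (h'.eq_of_le hu Set.subset_union_right).symm

end EndComponents

/-! ### Limit sets of plays. -/

section LimitSets

variable {V : Type*} [Finite V] {G : MDPGraph V}

theorem MDPGraph.IsEC.exists_isMECWithout {F U : Set V} (h : G.IsEC U) (hF : Disjoint U F) :
    ∃ C, U ⊆ C ∧ G.IsMECWithout F C :=
  Set.Finite.exists_le_maximal (s := {U | G.IsEC U ∧ Disjoint U F}) (Set.toFinite _) ⟨h, hF⟩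

theorem eventually_mem_infSet (ρ : ℕ → V) : ∀ᶠ t in Filter.atTop, ρ t ∈ infSet ρ := by
  have : ∀ u : V, ∀ᶠ t in Filter.atTop, ρ t = u → u ∈ infSet ρ := fun u => by
    by_cases hu : u ∈ infSet ρ
    · exact Filter.Eventually.of_forall fun _ _ => hu
    · filter_upwards [Filter.not_frequently.1 hu] with t ht h using absurd h ht
  filter_upwards [Filter.eventually_all.2 this] with t ht using ht _ rfl

theorem infSet_nonempty (ρ : ℕ → V) : (infSet ρ).Nonempty :=
  let ⟨t, ht⟩ := (eventually_mem_infSet ρ).exists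
  ⟨ρ t, ht⟩

theorem exists_ge_of_mem_infSet {ρ : ℕ → V} {v : V} (h : v ∈ infSet ρ) (N : ℕ) :
    ∃ t, N ≤ t ∧ ρ t = v := (Filter.frequently_atTop.1 h) N

/-- If the play moves along edges and its limit set is closed under probabilistic moves, then the
limit set is an end-component. -/
theorem isEC_infSet {ρ : ℕ → V} (hE : ∀ t, G.E (ρ t) (ρ (t + 1)))
    (hcl : ∀ u v, G.E u v → u ∈ G.VP → u ∈ infSet ρ → v ∈ infSet ρ) : G.IsEC (infSet ρ) := by
  refine ⟨infSet_nonempty ρ, fun u hu v hv => ?_, fun u v e hu hp => hcl u v e hp hu⟩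
  obtain ⟨N, hN⟩ := Filter.eventually_atTop.1 (eventually_mem_infSet ρ)
  obtain ⟨a, ha, rfl⟩ := exists_ge_of_mem_infSet hu N
  -- The segment of the play from time `a` to time `b` is the required path; starting at `a + 1`
  -- makes it nonempty even if the two vertices coincide.
  obtain ⟨b, hb, rfl⟩ := exists_ge_of_mem_infSet hv (a + 1)
  induction b, hb using Nat.le_induction with
  | base => exact .single ⟨hu, hv, hE a⟩
  | succ b hb ih =>
    have hbi : ρ b ∈ infSet ρ := hN b (by omega)
    exact (ih hbi).tail ⟨hbi, hv, hE b⟩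

/-- A ranked family of end-components: following the component of the current vertex fairly, a play
ends up covering exactly one component. -/
theorem infSet_eq_of_ranked {W : Set V} (rank : V → ℕ) (C : V → Set V)
    (hC : ∀ v ∈ W, G.IsEC (C v)) (hself : ∀ v ∈ W, v ∈ C v)
    (hrank : ∀ v ∈ W, ∀ u ∈ C v, u ∈ W ∧ rank u ≤ rank v ∧ (rank u = rank v → C u = C v))
    {ρ : ℕ → V} (hmove : ∀ t, ρ t ∈ W → ρ (t + 1) ∈ C (ρ t))
    (hinf : ∀ v u, v ∈ infSet ρ → v ∈ W → u ∈ C v → G.E v u → u ∈ infSet ρ)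
    (hreach : ρ ∈ reach W) : ∃ v ∈ W, infSet ρ = C v := by
  obtain ⟨T, hT⟩ := hreach
  have hstay : ∀ t, T ≤ t → ρ t ∈ W := fun t ht => by
    induction t, ht using Nat.le_induction with
    | base => exact hT
    | succ t _ ih => exact (hrank _ ih _ (hmove t ih)).1
  have hsub : ∀ u ∈ infSet ρ, u ∈ W := fun u hu => by
    obtain ⟨t, ht, rfl⟩ := exists_ge_of_mem_infSet hu T
    exact hstay t ht
  -- At a limit vertex of least rank, the limit vertices inside `C v` cannot have smaller rank,
  -- hence share the component `C v`. So the play, once at `v` after it has settled in its limit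
  -- set, never leaves `C v`.
  obtain ⟨v, hv, hmin⟩ := Set.exists_min_image (infSet ρ) rank (Set.toFinite _) (infSet_nonempty ρ)
  have heq : ∀ u ∈ infSet ρ, u ∈ C v → C u = C v := fun u hu huC =>
    have h := hrank v (hsub v hv) u huC
    h.2.2 (h.2.1.antisymm (hmin u hu))
  refine ⟨v, hsub v hv, Set.Subset.antisymm (fun u hu => ?_) fun u hu => ?_⟩
  · obtain ⟨N, hN⟩ := Filter.eventually_atTop.1 (eventually_mem_infSet ρ)
    obtain ⟨a, ha, hav⟩ := exists_ge_of_mem_infSet hv (max N T)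
    obtain ⟨b, hb, rfl⟩ := exists_ge_of_mem_infSet hu a
    clear hu
    induction b, hb using Nat.le_induction with
    | base => rw [hav]; exact hself v (hsub v hv)
    | succ b hb ih =>
      have hbi : ρ b ∈ infSet ρ := hN b (by omega)
      rw [← heq _ hbi ih]
      exact hmove b (hsub _ hbi)
  -- Fairness carries membership in the limit set along each path inside `C v`.
  · have hp := (hC v (hsub v hv)).connected v (hself v (hsub v hv)) u hu
    clear hu
    induction hp with
    | single h => exact hinf v _ hv (hsub v hv) h.2.1 h.2.2
    | tail _ h ih => exact hinf _ _ ih (hsub _ ih) (by rw [heq _ ih h.1]; exact h.2.1) h.2.2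

end LimitSets

/-! ### The optimal value of a generalized Rabin condition. -/

section Value

variable {V : Type*} [Fintype V] [MeasurableSpace V] [MeasurableSingletonClass V]

/-- At a probabilistic vertex the move probabilities do not depend on the history, so
`MDP.law_infSet_step` closes the limit set under probabilistic edges, whatever the strategy. -/
theorem MDP.law_isEC_infSet (M : MDP V) (σ : M.Strategy) (v : V) :
    ∀ᵐ ρ ∂M.law σ v, M.IsEC (infSet ρ) := by
  have h : ∀ u w : V, ∀ᵐ ρ ∂M.law σ v, M.E u w → u ∈ M.VP → u ∈ infSet ρ → w ∈ infSet ρ := by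
    intro u w
    by_cases he : M.E u w ∧ u ∈ M.VP
    · obtain ⟨he, hp⟩ := he
      filter_upwards [M.law_infSet_step σ v u w _ ((M.edge_iff ⟨u, hp⟩ w).1 he)
        fun t h ht => by subst ht; simp [MDP.next, hp]] with ρ hρ _ _ using hρ
    · exact Filter.Eventually.of_forall fun ρ h1 h2 => absurd ⟨h1, h2⟩ he
  filter_upwards [M.law_support σ v, ae_all_iff.2 fun u => ae_all_iff.2 (h u)] with ρ h1 h2
  refine isEC_infSet (fun t => ?_) h2
  have h3 := pos_iff_ne_zero.2 (h1 t)
  by_cases hp : ρ t ∈ M.VP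
  · exact (M.edge_iff ⟨ρ t, hp⟩ _).2 (by simpa [MDP.next, hp] using h3)
  · exact σ.legal t (fun i => ρ i) _ hp (by simpa [MDP.next, hp] using h3)

/-- The limit set of an accepted play extends to a maximal end-component avoiding `F`, and enlarging
it preserves the intersections with the sets of `I`. -/
theorem MDP.law_accepted_le (M : MDP V) (GR : List (GRPair V)) (σ : M.Strategy) (v : V) :
    M.law σ v (accepted GR) ≤ M.law σ v (reach (M.winning GR)) := by
  refine measure_mono_ae ?_
  filter_upwards [M.law_isEC_infSet σ v] with ρ hρ ⟨p, hp, hF, hI⟩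
  have hd : Disjoint (infSet ρ) p.F := by rw [disjoint_comm, Set.disjoint_iff_inter_eq_empty, hF]
  obtain ⟨C, hsub, hC⟩ := hρ.exists_isMECWithout hd
  obtain ⟨u, hu⟩ := infSet_nonempty ρ
  obtain ⟨t, -, rfl⟩ := exists_ge_of_mem_infSet hu 0
  exact ⟨t, p, hp, C, ⟨hC, fun S hS => (hI S hS).mono fun x hx => ⟨hsub hx.2, hx.1⟩⟩, hsub hu⟩

/-- The memoryless strategy that moves uniformly at random within `A`. -/
noncomputable def MDP.uniformStrategy (M : MDP V) (A : V → Finset V) (hA : ∀ v, (A v).Nonempty)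
    (hE : ∀ v, ∀ u ∈ A v, M.E v u) : M.Strategy where
  choose t h := PMF.uniformOfFinset (A (h ⟨t, Finset.mem_Iic.2 le_rfl⟩)) (hA _)
  legal t h u _ hu := hE _ _ (by
    rw [← PMF.mem_support_uniformOfFinset_iff (hA _), PMF.mem_support_iff]
    exact hu.ne')

theorem MDP.next_uniformStrategy (M : MDP V) (A : V → Finset V) (hA : ∀ v, (A v).Nonempty)
    (hE : ∀ v, ∀ u ∈ A v, M.E v u) (t : ℕ) (h : Finset.Iic t → V) (u : V) :
    M.next (M.uniformStrategy A hA hE) t h u ≠ 0 ↔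
      M.E (h ⟨t, Finset.mem_Iic.2 le_rfl⟩) u ∧ (h ⟨t, Finset.mem_Iic.2 le_rfl⟩ ∉ M.VP →
        u ∈ A (h ⟨t, Finset.mem_Iic.2 le_rfl⟩)) := by
  by_cases hp : h ⟨t, Finset.mem_Iic.2 le_rfl⟩ ∈ M.VP
  · rw [← pos_iff_ne_zero]
    have := M.edge_iff ⟨_, hp⟩ u
    simp only [MDP.next, hp, dif_pos, this]
    simp
  · simp only [MDP.next, hp, dif_neg, not_false_eq_true, uniformStrategy, true_implies]
    rw [← PMF.mem_support_iff, PMF.mem_support_uniformOfFinset_iff]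
    exact ⟨fun h => ⟨hE _ _ h, h⟩, fun h => h.2⟩

theorem MDP.law_uniformStrategy (M : MDP V) (A : V → Finset V) (hA : ∀ v, (A v).Nonempty)
    (hE : ∀ v, ∀ u ∈ A v, M.E v u) (v₀ : V) :
    ∀ᵐ ρ ∂M.law (M.uniformStrategy A hA hE) v₀,
      (∀ t, M.E (ρ t) (ρ (t + 1)) ∧ (ρ t ∉ M.VP → ρ (t + 1) ∈ A (ρ t))) ∧
      ∀ v u, v ∈ infSet ρ → M.E v u → (v ∉ M.VP → u ∈ A v) → u ∈ infSet ρ := by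
  have h : ∀ v u : V, ∀ᵐ ρ ∂M.law (M.uniformStrategy A hA hE) v₀, v ∈ infSet ρ → M.E v u →
      (v ∉ M.VP → u ∈ A v) → u ∈ infSet ρ := by
    intro v u
    by_cases he : M.E v u ∧ (v ∉ M.VP → u ∈ A v)
    -- The strategy is memoryless, so the probability read off the one-vertex history `h₀` is the
    -- move probability at every history ending in `v`.
    · let h₀ : Finset.Iic 0 → V := fun _ => v
      have hpos := (M.next_uniformStrategy A hA hE 0 h₀ u).2 he
      filter_upwards [M.law_infSet_step (M.uniformStrategy A hA hE) v₀ v u _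
        (pos_iff_ne_zero.2 hpos) fun t h ht => le_of_eq (by
          subst ht; simp [h₀, MDP.next, uniformStrategy])] with ρ hρ h1 _ _ using hρ h1
    · exact Filter.Eventually.of_forall fun ρ _ h1 h2 => absurd ⟨h1, h2⟩ he
  filter_upwards [M.law_support (M.uniformStrategy A hA hE) v₀,
    ae_all_iff.2 fun u => ae_all_iff.2 (h u)] with ρ h1 h2
  exact ⟨fun t => (M.next_uniformStrategy A hA hE t (fun i => ρ i) _).1 (h1 t), h2⟩

/-- One strategy attains the value of reaching the winning set, and wins almost surely once it is
there. -/
theorem MDP.exists_strategy_accepted (M : MDP V) (GR : List (GRPair V)) :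
    ∃ τ : M.Strategy, ∀ v, M.reachValue (M.winning GR) v ≤ M.law τ v (accepted GR) := by
  classical
  set W := M.winning GR with hW
  -- Every vertex of `C v` wins for pair `rank v`, so its own first winning pair comes no later; at
  -- equal rank, disjointness of the components of one pair forces the same component.
  let rank : V → ℕ := fun v => GR.findIdx fun p => v ∈ M.winningSet p
  have hrank : ∀ v ∈ W, ∃ h : rank v < GR.length, v ∈ M.winningSet GR[rank v] := by
    rintro v ⟨p, hp, hv⟩
    have h : rank v < GR.length := List.findIdx_lt_length_of_exists ⟨p, hp, by simpa using hv⟩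
    exact ⟨h, by simpa using List.findIdx_getElem (w := h)⟩
  have hcomp : ∀ v, ∃ C : Set V, v ∈ W → ∃ h : rank v < GR.length,
      (M.IsMECWithout GR[rank v].F C ∧ ∀ S ∈ GR[rank v].I, (C ∩ S).Nonempty) ∧ v ∈ C := by
    intro v
    by_cases hv : v ∈ W
    · obtain ⟨h, C, hC, hvC⟩ := hrank v hv
      exact ⟨C, fun _ => ⟨h, hC, hvC⟩⟩
    · exact ⟨∅, fun h => absurd h hv⟩
  choose C hC using hcomp
  have hEC : ∀ v ∈ W, M.IsEC (C v) := fun v hv => (hC v hv).2.1.1.prop.1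
  have hself : ∀ v ∈ W, v ∈ C v := fun v hv => (hC v hv).2.2
  have hranked : ∀ v ∈ W, ∀ u ∈ C v,
      u ∈ W ∧ rank u ≤ rank v ∧ (rank u = rank v → C u = C v) := by
    intro v hv u hu
    obtain ⟨h, hMEC, -⟩ := hC v hv
    have huw : u ∈ M.winningSet GR[rank v] := ⟨C v, hMEC, hu⟩
    have huW : u ∈ W := ⟨_, List.getElem_mem h, huw⟩
    refine ⟨huW, ?_, fun he => ?_⟩
    · by_contra hlt
      have := List.not_of_lt_findIdx (not_le.1 hlt)
      simp [huw] at this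
    · obtain ⟨h', hMEC', hu'⟩ := hC u huW
      have h1 := hMEC'.1
      simp only [he] at h1
      exact h1.eq_of_mem hMEC.1 hu' hu
  have hstep : ∀ v ∈ W, ∃ u ∈ C v, M.E v u := fun v hv => by
    obtain ⟨_, h, _⟩ := Relation.TransGen.head'_iff.1
      ((hEC v hv).connected v (hself v hv) v (hself v hv))
    exact ⟨_, h.2.1, h.2.2⟩
  -- At probabilistic vertices the strategy is never consulted, and only nonemptiness of `A v`
  -- matters.
  let A : V → Finset V := fun v => Finset.univ.filter fun u => M.E v u ∧
    if v ∈ W then u ∈ C v else v ∉ M.VP → M.reachValue W u = M.reachValue W v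
  have hA : ∀ v, (A v).Nonempty := fun v => by
    by_cases hv : v ∈ W
    · obtain ⟨u, hu, e⟩ := hstep v hv
      exact ⟨u, by simp [A, hv, hu, e]⟩
    · by_cases hp : v ∈ M.VP
      · obtain ⟨u, e⟩ := M.total v
        exact ⟨u, by simp [A, hv, hp, e]⟩
      · obtain ⟨u, e, hu⟩ := M.exists_optimal_edge W hv hp
        exact ⟨u, by simp [A, hv, hu, e]⟩
  have hAE : ∀ v, ∀ u ∈ A v, M.E v u := fun v u hu => (Finset.mem_filter.1 hu).2.1
  refine ⟨M.uniformStrategy A hA hAE, fun v => ?_⟩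
  have hlaw := M.law_uniformStrategy A hA hAE v
  have hAW : ∀ v ∈ W, ∀ u, (u ∈ A v ↔ M.E v u ∧ u ∈ C v) := fun v hv u => by simp [A, hv]
  have hAnW : ∀ v ∉ W, ∀ u, (u ∈ A v ↔ M.OptEdge W v u) := fun v hv u => by
    simp [A, hv, MDP.OptEdge]
  refine (M.le_law_reach W (M.uniformStrategy A hA hAE) v ?_ ?_).trans (measure_mono_ae ?_)
  · intro t h u hh hu
    rw [M.next_uniformStrategy] at hu
    exact ⟨hu.1, fun hp => ((hAnW _ hh _).1 (hu.2 hp)).2 hp⟩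
  -- A vertex of positive value visited infinitely often would, by fairness along a path of optimal
  -- edges, drag the play into `W`.
  · filter_upwards [hlaw] with ρ ⟨_, h2⟩ hr u hu
    by_contra hpos
    obtain ⟨w, hw, hpath⟩ := M.exists_path_of_reachValue_pos W hpos
    have : w ∈ infSet ρ := by
      clear hw
      induction hpath with
      | refl => exact hu
      | tail _ h ih => exact h2 _ _ ih h.2.1 fun _ => (hAnW _ h.1 _).2 h.2
    obtain ⟨t, -, rfl⟩ := exists_ge_of_mem_infSet this 0
    exact hr ⟨t, hw⟩
  · filter_upwards [hlaw] with ρ ⟨h1, h2⟩ hr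
    obtain ⟨w, hw, hI⟩ := infSet_eq_of_ranked (G := M.toMDPGraph) rank C hEC hself hranked
      (fun t ht => by
        by_cases hp : ρ t ∈ M.VP
        · exact (hEC _ ht).closed _ _ (h1 t).1 (hself _ ht) hp
        · exact ((hAW _ ht _).1 ((h1 t).2 hp)).2)
      (fun a b ha haW hb e => h2 a b ha e fun _ => (hAW a haW b).2 ⟨e, hb⟩) hr
    obtain ⟨h, hMEC, -⟩ := hC w hw
    refine ⟨GR[rank w], List.getElem_mem h, ?_, fun S hS => ?_⟩
    · rw [hI, ← Set.disjoint_iff_inter_eq_empty]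
      exact hMEC.1.prop.2.symm
    · rw [hI, Set.inter_comm]
      exact hMEC.2 S hS

theorem MDP.value_accepted (M : MDP V) (GR : List (GRPair V)) (v : V) :
    M.value (accepted GR) v = M.reachValue (M.winning GR) v := by
  obtain ⟨τ, hτ⟩ := M.exists_strategy_accepted GR
  exact le_antisymm
    (iSup_le fun σ => (M.law_accepted_le GR σ v).trans (M.law_reach_le _ σ v))
    ((hτ v).trans (le_iSup (fun σ => M.law σ v (accepted GR)) τ))

/-- For the strategy of `MDP.exists_strategy_accepted`, the probability of reaching the target is
squeezed between its acceptance probability and `MDP.reachValue`, so it attains the maximum. -/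
theorem MDP.isGreatest_value_accepted (M : MDP V) (GR : List (GRPair V)) (v : V) :
    IsGreatest (Set.range fun σ : M.Strategy => M.law σ v (reach (M.winning GR)))
      (M.value (accepted GR) v) := by
  rw [M.value_accepted]
  obtain ⟨τ, hτ⟩ := M.exists_strategy_accepted GR
  refine ⟨⟨τ, (M.law_reach_le _ τ v).antisymm ((hτ v).trans (M.law_accepted_le GR τ v))⟩, ?_⟩
  rintro _ ⟨σ, rfl⟩
  exact M.law_reach_le _ σ v

end Value

/-! ### The linear program for the reachability value. -/

section LinearProgram

variable {n : ℕ} (M : MDP (Fin n)) (W : Set (Fin n)) (es : List (Fin n × Fin n))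

open Classical in
/-- The coefficient of the variable `v` in the lower bound on the variable of the source of the
edge `e`. -/
noncomputable def MDP.reachCoeff (e : Fin n × Fin n) (v : Fin n) : ℝ :=
  if e.1 ∈ W then 0 else if e.1 ∈ M.VP then M.prob (e.1, v) else if v = e.2 then 1 else 0

open Classical in
/-- The linear program for the probability to reach `W`, with one constraint for every edge. -/
noncomputable def MDP.reachLP : LinProg n es.length where
  A := fun i v => (if v = es[i].1 then 1 else 0) - M.reachCoeff W es[i] v
  b := fun i => if es[i].1 ∈ W then 1 else 0
  c := fun _ => 1

theorem MDP.reachLP_mulVec (y : Fin n → ℝ) (i : Fin es.length) :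
    (M.reachLP W es).A.mulVec y i = y es[i].1 - ∑ v, M.reachCoeff W es[i] v * y v := by
  classical
  simp only [Matrix.mulVec, dotProduct, reachLP, sub_mul, Finset.sum_sub_distrib, ite_mul, one_mul,
    zero_mul, Finset.sum_ite_eq', Finset.mem_univ, if_true]

/-- Indexing constraints by edges gives exactly `m` of them. Edges with a common source in `W` or
`VP` repeat one constraint; since every vertex has a successor, no vertex lacks its constraint. -/
theorem MDP.reachLP_feasible_iff (hes : M.IsEdgeList es) (y : Fin n → ℝ) :
    (M.reachLP W es).Feasible y ↔ 0 ≤ y ∧ (∀ v ∈ W, 1 ≤ y v) ∧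
      (∀ v ∉ W, ∀ h : v ∈ M.VP, ∑ u, (M.δ ⟨v, h⟩ u).toReal * y u ≤ y v) ∧
      ∀ v ∉ W, v ∉ M.VP → ∀ u, M.E v u → y u ≤ y v := by
  classical
  have hedge : (∀ i, (M.reachLP W es).b i ≤ (M.reachLP W es).A.mulVec y i) ↔
      ∀ e ∈ es, (if e.1 ∈ W then (1 : ℝ) else 0) ≤ y e.1 - ∑ v, M.reachCoeff W e v * y v := by
    simp only [M.reachLP_mulVec]
    exact ⟨fun h e he => by
      obtain ⟨i, hi, rfl⟩ := List.getElem_of_mem he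
      exact h ⟨i, hi⟩, fun h i => h _ (List.getElem_mem _)⟩
  rw [LinProg.Feasible, Pi.le_def (x := LinProg.b _), hedge]
  refine and_congr_right fun _ => ⟨fun h => ⟨fun v hv => ?_,
    fun v hv hp => ?_, fun v hv hp u e => ?_⟩,
    fun ⟨h1, h2, h3⟩ e he => ?_⟩
  · obtain ⟨u, e⟩ := M.total v
    simpa [reachCoeff, hv] using h (v, u) ((hes.2 v u).2 e)
  · obtain ⟨u, e⟩ := M.total v
    simpa [reachCoeff, hv, hp, prob] using h (v, u) ((hes.2 v u).2 e)
  · simpa [reachCoeff, hv, hp] using h (v, u) ((hes.2 v u).2 e)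
  · by_cases hv : e.1 ∈ W
    · simpa [reachCoeff, hv] using h1 _ hv
    · by_cases hp : e.1 ∈ M.VP
      · simpa [reachCoeff, hv, hp, prob] using h2 _ hv hp
      · simpa [reachCoeff, hv, hp] using h3 _ hv hp _ ((hes.2 e.1 e.2).1 he)

theorem MDP.reachValue_ne_top (v : Fin n) : M.reachValue W v ≠ ∞ :=
  ne_top_of_le_ne_top ENNReal.one_ne_top (M.reachValue_le_one W v)

theorem MDP.reachLP_feasible_reachValue (hes : M.IsEdgeList es) :
    (M.reachLP W es).Feasible fun v => (M.reachValue W v).toReal := by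
  rw [M.reachLP_feasible_iff W es hes]
  refine ⟨fun v => ENNReal.toReal_nonneg, fun v hv => ?_, fun v hv hp => ?_, fun v hv hp u e => ?_⟩
  · rw [M.reachValue_of_mem W hv]; simp
  · rw [M.reachValue_prob W hv hp, ENNReal.toReal_sum fun u _ =>
      ENNReal.mul_ne_top (PMF.apply_ne_top _ _) (M.reachValue_ne_top W u)]
    simp
  · exact ENNReal.toReal_mono (M.reachValue_ne_top W v) (M.reachValue_le_of_edge W hv hp e)

/-- A feasible point is a pre-fixed point of the Bellman operator, hence above the least one. No
constraint setting hopeless vertices to zero is needed. -/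
theorem MDP.reachValue_le_of_feasible (hes : M.IsEdgeList es) {y : Fin n → ℝ}
    (hy : (M.reachLP W es).Feasible y) (v : Fin n) : (M.reachValue W v).toReal ≤ y v := by
  rw [M.reachLP_feasible_iff W es hes] at hy
  obtain ⟨h0, h1, h2, h3⟩ := hy
  refine ENNReal.toReal_le_of_le_ofReal (h0 v)
    (M.reachValue_le W (x := fun v => ENNReal.ofReal (y v)) (fun v => ?_) v)
  rw [bellman_apply]
  split_ifs with hv hp
  · simpa using h1 v hv
  · refine le_trans (le_of_eq ?_) (ENNReal.ofReal_le_ofReal (h2 v hv hp))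
    rw [ENNReal.ofReal_sum_of_nonneg fun u _ => mul_nonneg ENNReal.toReal_nonneg (h0 u)]
    refine Finset.sum_congr rfl fun u _ => ?_
    rw [ENNReal.ofReal_mul ENNReal.toReal_nonneg, ENNReal.ofReal_toReal (PMF.apply_ne_top _ _)]
  · exact iSup_le fun u => ENNReal.ofReal_le_ofReal (h3 v hv hp u u.2)

theorem MDP.reachLP_isOptimal_reachValue (hes : M.IsEdgeList es) :
    (M.reachLP W es).IsOptimal fun v => (M.reachValue W v).toReal :=
  ⟨M.reachLP_feasible_reachValue W es hes, fun y hy => by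
    simp only [reachLP, dotProduct, one_mul]
    exact Finset.sum_le_sum fun v _ => M.reachValue_le_of_feasible W es hes hy v⟩

/-- All objective weights are positive, so a feasible point above the least one pointwise and with
the same sum coincides with it. -/
theorem MDP.eq_reachValue_of_isOptimal (hes : M.IsEdgeList es) {y : Fin n → ℝ}
    (hy : (M.reachLP W es).IsOptimal y) (v : Fin n) : y v = (M.reachValue W v).toReal := by
  have hle := hy.2 _ (M.reachLP_feasible_reachValue W es hes)
  simp only [reachLP, dotProduct, one_mul] at hle
  have heq := (Finset.sum_eq_sum_iff_of_le fun v _ =>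
    M.reachValue_le_of_feasible W es hes hy.1 v).1 (le_antisymm
      (Finset.sum_le_sum fun v _ => M.reachValue_le_of_feasible W es hes hy.1 v) hle)
  exact (heq v (Finset.mem_univ v)).symm

end LinearProgram

/-! ### Rules for correctness and running time of programs. -/

section Programs

/-- Started in `s`, the program halts, and the running time and the final memory satisfy `Q`. -/
def Prog.wp (p : Prog) (s : Store) (Q : ℕ → Store → Prop) : Prop :=
  ∃ t s', Exec p s t s' ∧ Q t s'

theorem Prog.wp.mono {p : Prog} {s : Store} {Q Q' : ℕ → Store → Prop} (h : p.wp s Q)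
    (hQ : ∀ t s', Q t s' → Q' t s') : p.wp s Q' :=
  let ⟨t, s', he, hq⟩ := h
  ⟨t, s', he, hQ t s' hq⟩

theorem Prog.wp_skip {s : Store} {Q : ℕ → Store → Prop} (h : Q 1 s) : Prog.skip.wp s Q :=
  ⟨_, _, Exec.skip s, h⟩

theorem Prog.wp_nset {a : ℕ} {i e : NExp} {s : Store} {Q : ℕ → Store → Prop}
    (h : Q (1 + i.cost + e.cost) (s.setNat a (i.eval s) (e.eval s))) : (Prog.nset a i e).wp s Q :=
  ⟨_, _, Exec.nset s a i e, h⟩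

theorem Prog.wp_rset {a : ℕ} {i : NExp} {e : RExp} {s : Store} {Q : ℕ → Store → Prop}
    (h : Q (1 + i.cost + e.cost) (s.setReal a (i.eval s) (e.eval s))) : (Prog.rset a i e).wp s Q :=
  ⟨_, _, Exec.rset s a i e, h⟩

theorem Prog.wp_seq {p q : Prog} {s : Store} {Q : ℕ → Store → Prop}
    (h : p.wp s fun t s' => q.wp s' fun t' s'' => Q (t + t') s'') : (Prog.seq p q).wp s Q :=
  let ⟨_, _, h1, _, _, h2, hq⟩ := h
  ⟨_, _, Exec.seq h1 h2, hq⟩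

theorem Prog.wp_ite {b : BExp} {p q : Prog} {s : Store} {Q : ℕ → Store → Prop}
    (h1 : b.Holds s → p.wp s fun t => Q (1 + b.cost + t))
    (h2 : ¬ b.Holds s → q.wp s fun t => Q (1 + b.cost + t)) : (Prog.ite b p q).wp s Q := by
  by_cases hb : b.Holds s
  · obtain ⟨t, s', h, hq⟩ := h1 hb
    exact ⟨_, _, Exec.ite_true hb h, hq⟩
  · obtain ⟨t, s', h, hq⟩ := h2 hb
    exact ⟨_, _, Exec.ite_false hb h, hq⟩

theorem Prog.wp_call {p : Prog} {ns rs : List (ℕ × NExp)} {nout rout : ℕ × NExp} {s : Store}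
    {Q : ℕ → Store → Prop}
    (h : p.wp (s.args ns rs).load fun t s' =>
      Q (1 + (ns.map fun x => x.2.cost).sum + (rs.map fun x => x.2.cost).sum
          + nout.2.cost + rout.2.cost
          + (s.args ns rs).size + t + nout.2.eval s + rout.2.eval s)
        (s.ret s' nout.1 (nout.2.eval s) rout.1 (rout.2.eval s))) :
    (Prog.call p ns rs nout rout).wp s Q :=
  let ⟨_, _, he, hq⟩ := h
  ⟨_, _, Exec.call he, hq⟩

theorem Store.setNat_self (s : Store) (a i x : ℕ) :
    (s.setNat a i x).nat a = Function.update (s.nat a) i x := by simp [setNat]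

theorem Store.setNat_ne (s : Store) {a b : ℕ} (i x : ℕ) (h : b ≠ a) :
    (s.setNat a i x).nat b = s.nat b := by simp [setNat, h]

theorem Store.setNat_real (s : Store) (a i x : ℕ) : (s.setNat a i x).real = s.real := rfl

theorem Store.setReal_nat (s : Store) (a i : ℕ) (x : ℝ) : (s.setReal a i x).nat = s.nat := rfl

theorem Store.setReal_self (s : Store) (a i : ℕ) (x : ℝ) :
    (s.setReal a i x).real a = Function.update (s.real a) i x := by simp [setReal]

theorem Store.setReal_ne (s : Store) {a b : ℕ} (i : ℕ) (x : ℝ) (h : b ≠ a) :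
    (s.setReal a i x).real b = s.real b := by simp [setReal, h]

/-- At most the natural arrays in `A` and the real arrays in `B` have changed. -/
structure Frame (A B : List ℕ) (s s' : Store) : Prop where
  nat : ∀ a, a ∉ A → s'.nat a = s.nat a
  real : ∀ a, a ∉ B → s'.real a = s.real a

theorem Frame.refl (A B : List ℕ) (s : Store) : Frame A B s s := ⟨fun _ _ => rfl, fun _ _ => rfl⟩

theorem Frame.setNat {A B : List ℕ} {s s' : Store} (h : Frame A B s s') {a : ℕ} (i x : ℕ)
    (ha : a ∈ A) : Frame A B s (s'.setNat a i x) :=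
  ⟨fun b hb => by rw [s'.setNat_ne _ _ (by rintro rfl; exact hb ha), h.nat b hb],
    fun b hb => h.real b hb⟩

theorem Frame.setReal {A B : List ℕ} {s s' : Store} (h : Frame A B s s') {a : ℕ} (i : ℕ) (x : ℝ)
    (ha : a ∈ B) : Frame A B s (s'.setReal a i x) :=
  ⟨fun b hb => h.nat b hb,
    fun b hb => by rw [s'.setReal_ne _ _ (by rintro rfl; exact hb ha), h.real b hb]⟩

theorem Frame.trans {A B A' B' : List ℕ} {s s' s'' : Store} (h : Frame A B s s')
    (h' : Frame A' B' s' s'') (hA : A' ⊆ A) (hB : B' ⊆ B) : Frame A B s s'' :=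
  ⟨fun a ha => (h'.nat a fun h => ha (hA h)).trans (h.nat a ha),
    fun a ha => (h'.real a fun h => ha (hB h)).trans (h.real a ha)⟩

/-- The first cell of a natural array. -/
def NExp.var (a : ℕ) : NExp := .get a (.lit 0)

theorem NExp.eval_var (a : ℕ) (s : Store) : (NExp.var a).eval s = s.nat a 0 := rfl

theorem NExp.cost_var (a : ℕ) : (NExp.var a).cost = 2 := rfl

/-- Run `p` with the values `0, …, N - 1` of the variable `x`. -/
def Prog.for (x : ℕ) (N : NExp) (p : Prog) : Prog :=
  .seq (.nset x (.lit 0) (.lit 0))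
    (.loop (.natLt (.var x) N) (.seq p (.nset x (.lit 0) (.add (.var x) (.lit 1)))))

/-- The body may have a different time bound in each round; for the loop over the pairs this is what
produces the sum of the `ℓ_i` instead of `k` times their maximum. -/
theorem Prog.wp_for_sum {x : ℕ} {N : NExp} {p : Prog} {s : Store} {Q : ℕ → Store → Prop}
    (k : ℕ) (T : ℕ → ℕ) (Inv : ℕ → Store → Prop)
    (hN : ∀ i ≤ k, ∀ s, Inv i s → s.nat x 0 = i → N.eval s = k)
    (h0 : Inv 0 (s.setNat x 0 0))
    (hstep : ∀ i < k, ∀ s, Inv i s → s.nat x 0 = i →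
      p.wp s fun t s' => t ≤ T i ∧ s'.nat x 0 = i ∧ Inv (i + 1) (s'.setNat x 0 (i + 1)))
    (hQ : ∀ t s, t ≤ ∑ i ∈ Finset.range k, (T i + N.cost + 10) + N.cost + 7 → Inv k s →
      s.nat x 0 = k → Q t s) :
    (Prog.for x N p).wp s Q := by
  have hx : ∀ (s : Store) i, (s.setNat x 0 i).nat x 0 = i := fun s i => by
    simp [Store.setNat_self]
  have hloop : ∀ d i, i + d = k → ∀ s, Inv i s → s.nat x 0 = i →
      (Prog.loop (.natLt (.var x) N) (.seq p (.nset x (.lit 0) (.add (.var x) (.lit 1))))).wp s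
        fun t s' => t ≤ ∑ j ∈ Finset.range d, (T (i + j) + N.cost + 10) + N.cost + 4 ∧
          Inv k s' ∧ s'.nat x 0 = k := by
    intro d
    induction d with
    | zero =>
      rintro i rfl s hi hs
      refine ⟨_, s, Exec.loop_done ?_, ?_, hi, hs⟩
      · simp only [BExp.Holds, NExp.eval_var, hs, hN _ le_rfl s hi hs, add_zero]
        exact lt_irrefl _
      · simp only [BExp.cost, NExp.cost_var, Finset.sum_range_zero]; omega
    | succ d ih =>
      intro i hik s hi hs
      obtain ⟨t, s', he, ht, hs', hi'⟩ := hstep i (by omega) s hi hs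
      obtain ⟨t', s'', he', ht', hq⟩ := ih (i + 1) (by omega) _ hi' (hx _ _)
      have hinc := Exec.nset s' x (.lit 0) (.add (.var x) (.lit 1))
      simp only [NExp.eval, NExp.eval_var, hs'] at hinc
      refine ⟨_, s'', Exec.loop_step ?_ (Exec.seq he hinc) he', ?_, hq⟩
      · simp only [BExp.Holds, NExp.eval_var, hs, hN _ (by omega) s hi hs]; omega
      · rw [Finset.sum_range_succ']
        have : ∀ j, T (i + (j + 1)) = T (i + 1 + j) := fun j => by congr 1; omega
        rw [Finset.sum_congr rfl fun j _ => by rw [this j]]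
        simp only [BExp.cost, NExp.cost, NExp.cost_var, add_zero]
        omega
  obtain ⟨t, s', he, ht, hi, hs⟩ := hloop k 0 (zero_add k) _ h0 (hx _ _)
  refine ⟨_, s', Exec.seq (Exec.nset s x (.lit 0) (.lit 0)) he, hQ _ _ ?_ hi hs⟩
  simp only [zero_add] at ht
  simp only [NExp.cost]
  omega

theorem Prog.wp_for {x : ℕ} {N : NExp} {p : Prog} {s : Store} {Q : ℕ → Store → Prop}
    (k T : ℕ) (Inv : ℕ → Store → Prop)
    (hN : ∀ i ≤ k, ∀ s, Inv i s → s.nat x 0 = i → N.eval s = k)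
    (h0 : Inv 0 (s.setNat x 0 0))
    (hstep : ∀ i < k, ∀ s, Inv i s → s.nat x 0 = i →
      p.wp s fun t s' => t ≤ T ∧ s'.nat x 0 = i ∧ Inv (i + 1) (s'.setNat x 0 (i + 1)))
    (hQ : ∀ t s, t ≤ k * (T + N.cost + 10) + N.cost + 7 → Inv k s → s.nat x 0 = k → Q t s) :
    (Prog.for x N p).wp s Q :=
  Prog.wp_for_sum k (fun _ => T) Inv hN h0 hstep fun t s ht => hQ t s (by simpa using ht)

/-- `f` reads the list `l` from position `o` on. -/
def Reads {α : Type*} (f : ℕ → α) (o : ℕ) (l : List α) : Prop :=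
  ∀ i (h : i < l.length), f (o + i) = l[i]

theorem reads_nil {α : Type*} (f : ℕ → α) (o : ℕ) : Reads f o [] := fun _ h => by simp at h

theorem reads_append {α : Type*} {f : ℕ → α} {o : ℕ} {l l' : List α} :
    Reads f o (l ++ l') ↔ Reads f o l ∧ Reads f (o + l.length) l' := by
  refine ⟨fun h => ⟨fun i hi => ?_, fun i hi => ?_⟩, fun ⟨h1, h2⟩ i hi => ?_⟩
  · rw [h i (by simp; omega), List.getElem_append_left hi]
  · rw [add_assoc, h (l.length + i) (by simp; omega), List.getElem_append_right (by omega)]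
    simp
  · by_cases hl : i < l.length
    · rw [List.getElem_append_left hl, h1 i hl]
    · rw [List.getElem_append_right (not_lt.1 hl), ← h2]
      congr 1; omega

theorem reads_zero_iff {α : Type*} {f : ℕ → α} {l : List α} :
    Reads f 0 l ↔ (List.range l.length).map f = l := by
  refine ⟨fun h => List.ext_getElem (by simp) fun i h1 h2 => ?_, fun h i hi => ?_⟩
  · simpa using h i h2
  · conv_rhs => rw [List.getElem_of_eq h.symm]
    simp

theorem Reads.snoc {α : Type*} {f : ℕ → α} {l : List α} (h : Reads f 0 l) (x : α) :
    Reads (Function.update f l.length x) 0 (l ++ [x]) := by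
  rw [reads_append]
  refine ⟨fun i hi => ?_, fun i hi => ?_⟩
  · have := h i hi
    rw [zero_add] at this ⊢
    rw [Function.update_of_ne hi.ne, this]
  · obtain rfl : i = 0 := by simpa using hi
    simp

/-- A loop that conditionally writes a constant into one array. -/
theorem Prog.wp_condSet {x : ℕ} {N : NExp} {b : BExp} {a : ℕ} {ix : NExp} {c : ℕ} {s : Store}
    {Q : ℕ → Store → Prop} (k : ℕ) (P : ℕ → Prop) (f : ℕ → ℕ) (hxa : x ≠ a)
    (hN : ∀ s', Frame [x, a] [] s s' → N.eval s' = k)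
    (hsem : ∀ i < k, ∀ s', Frame [x, a] [] s s' → s'.nat x 0 = i →
      (b.Holds s' ↔ P i) ∧ ix.eval s' = f i)
    (hQ : ∀ t s', t ≤ k * (14 + b.cost + ix.cost + N.cost) + N.cost + 7 →
      Frame [x, a] [] s s' → (∀ j, (∃ i < k, P i ∧ f i = j) → s'.nat a j = c) →
      (∀ j, (¬ ∃ i < k, P i ∧ f i = j) → s'.nat a j = s.nat a j) → Q t s') :
    (Prog.for x N (.ite b (.nset a ix (.lit c)) .skip)).wp s Q := by
  -- All writes store the same constant, so `f` need not be injective: only the set of cells hit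
  -- matters.
  refine Prog.wp_for k (4 + b.cost + ix.cost)
    (fun m s' => Frame [x, a] [] s s' ∧ (∀ j, (∃ i < m, P i ∧ f i = j) → s'.nat a j = c) ∧
      ∀ j, (¬ ∃ i < m, P i ∧ f i = j) → s'.nat a j = s.nat a j)
    (fun i _ s' hi _ => hN s' hi.1) ?_ ?_ ?_
  · refine ⟨(Frame.refl _ _ s).setNat _ _ (by simp), by simp, fun j _ => ?_⟩
    rw [s.setNat_ne _ _ hxa.symm]
  · rintro i hi s' ⟨hF, h1, h2⟩ hs
    obtain ⟨hb, hix⟩ := hsem i hi s' hF hs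
    refine Prog.wp_ite (fun h => Prog.wp_nset ?_) (fun h => Prog.wp_skip ?_)
    · have hP := hb.1 h
      refine ⟨by simp only [NExp.cost]; omega, by rw [s'.setNat_ne _ _ hxa, hs],
        (hF.setNat _ _ (by simp)).setNat _ _ (by simp), fun j hj => ?_, fun j hj => ?_⟩
      · rw [Store.setNat_ne _ _ _ hxa.symm, Store.setNat_self, hix]
        by_cases hij : j = f i
        · rw [hij, Function.update_self]; rfl
        · rw [Function.update_of_ne hij]
          obtain ⟨i', hi', hP', hf⟩ := hj
          refine h1 j ⟨i', ?_, hP', hf⟩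
          rcases Nat.lt_succ_iff_lt_or_eq.1 hi' with h | rfl
          · exact h
          · exact absurd hf.symm hij
      · rw [Store.setNat_ne _ _ _ hxa.symm, Store.setNat_self, hix, Function.update_of_ne]
        · exact h2 j fun ⟨i', hi', h⟩ => hj ⟨i', hi'.trans (Nat.lt_succ_self i), h⟩
        · rintro rfl; exact hj ⟨i, Nat.lt_succ_self i, hP, rfl⟩
    · have hP : ¬ P i := fun hp => h (hb.2 hp)
      refine ⟨by omega, hs, hF.setNat _ _ (by simp), fun j hj => ?_, fun j hj => ?_⟩
      · rw [Store.setNat_ne _ _ _ hxa.symm]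
        obtain ⟨i', hi', hP', hf⟩ := hj
        refine h1 j ⟨i', ?_, hP', hf⟩
        rcases Nat.lt_succ_iff_lt_or_eq.1 hi' with h | rfl
        · exact h
        · exact absurd hP' hP
      · rw [Store.setNat_ne _ _ _ hxa.symm]
        exact h2 j fun ⟨i', hi', h⟩ => hj ⟨i', hi'.trans (Nat.lt_succ_self i), h⟩
  · rintro t s' ht ⟨hF, h1, h2⟩ -
    refine hQ t s' (ht.trans ?_) hF h1 h2
    have : 4 + b.cost + ix.cost + N.cost + 10 = 14 + b.cost + ix.cost + N.cost := by omega
    rw [this]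

/-- A loop that fills cells of one real array. -/
theorem Prog.wp_fillReal {x : ℕ} {N : NExp} {p : Prog} {a : ℕ} {s : Store}
    {Q : ℕ → Store → Prop} (k T : ℕ) (f : ℕ → ℕ) (val : ℕ → ℝ)
    (hf : ∀ i < k, ∀ j < k, f i = f j → i = j)
    (hN : ∀ s', Frame [x] [a] s s' → N.eval s' = k)
    (hsem : ∀ i < k, ∀ s', Frame [x] [a] s s' → s'.nat x 0 = i →
      p.wp s' fun t s'' => t ≤ T ∧ s'' = s'.setReal a (f i) (val i))
    (hQ : ∀ t s', t ≤ k * (T + N.cost + 10) + N.cost + 7 →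
      Frame [x] [a] s s' → (∀ i < k, s'.real a (f i) = val i) →
      (∀ j, (∀ i < k, f i ≠ j) → s'.real a j = s.real a j) → Q t s') :
    (Prog.for x N p).wp s Q := by
  refine Prog.wp_for k T
    (fun m s' => Frame [x] [a] s s' ∧ (∀ i < m, s'.real a (f i) = val i) ∧
      ∀ j, (∀ i < m, f i ≠ j) → s'.real a j = s.real a j)
    (fun i _ s' hi _ => hN s' hi.1) ?_ ?_ ?_
  · exact ⟨(Frame.refl _ _ s).setNat _ _ (by simp), by simp, fun j _ => rfl⟩
  · rintro i hi s' ⟨hF, h1, h2⟩ hs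
    refine (hsem i hi s' hF hs).mono ?_
    rintro t s'' ⟨ht, rfl⟩
    refine ⟨ht, hs, (hF.setReal _ _ (by simp)).setNat _ _ (by simp), fun j hj => ?_, fun j hj => ?_⟩
    · rw [Store.setNat_real, Store.setReal_self]
      rcases Nat.lt_succ_iff_lt_or_eq.1 hj with h | rfl
      · rw [Function.update_of_ne, h1 j h]
        intro he
        exact h.ne (hf j (h.trans hi) i hi he)
      · rw [Function.update_self]
    · rw [Store.setNat_real, Store.setReal_self, Function.update_of_ne]
      · exact h2 j fun i' hi' => hj i' (hi'.trans (Nat.lt_succ_self i))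
      · exact (hj i (Nat.lt_succ_self i)).symm
  · rintro t s' ht ⟨hF, h1, h2⟩ -
    exact hQ t s' ht hF h1 h2

end Programs

/-! ### Reducing the removal of `F` to an ordinary decomposition. -/

section Isolate

variable {V : Type*}

/-- The graph in which the vertices of `F` keep no edge but a self-loop. -/
def MDPGraph.isolate (G : MDPGraph V) (F : Set V) : MDPGraph V where
  E u v := (u ∈ F ∧ v = u) ∨ (u ∉ F ∧ G.E u v)
  VP := G.VP
  total u := by
    by_cases h : u ∈ F
    · exact ⟨u, .inl ⟨h, rfl⟩⟩
    · exact (G.total u).imp fun v e => .inr ⟨h, e⟩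

/-- From a vertex of `F` only the vertex itself is reachable, so its end-component is a singleton.
Other vertices keep their edges, in particular probabilistic edges into `F`, which still forbid an
end-component disjoint from `F`. -/
theorem MDPGraph.isEC_isolate_iff (G : MDPGraph V) (F U : Set V) :
    (G.isolate F).IsEC U ↔ (∃ u ∈ F, U = {u}) ∨ (G.IsEC U ∧ Disjoint U F) := by
  constructor
  · intro h
    by_cases hd : ∃ u ∈ U, u ∈ F
    · obtain ⟨u, hu, huF⟩ := hd
      refine .inl ⟨u, huF, Set.Subset.antisymm (fun v hv => ?_) (by simpa using hu)⟩
      have hp := h.connected u hu v hv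
      clear hv
      rw [Set.mem_singleton_iff]
      induction hp with
      | single h => exact (h.2.2.resolve_right fun h => h.1 huF).2
      | tail _ h ih => subst ih; exact (h.2.2.resolve_right fun h => h.1 huF).2
    · push Not at hd
      refine .inr ⟨⟨h.nonempty, fun u hu v hv =>
        Relation.TransGen.mono ?_ _ _ (h.connected u hu v hv),
        fun u v e hu hp => h.closed u v (.inr ⟨hd u hu, e⟩) hu hp⟩, Set.disjoint_left.2 hd⟩
      rintro a b ⟨ha, hb, e⟩
      exact ⟨ha, hb, (e.resolve_left fun h => hd a ha h.1).2⟩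
  · rintro (⟨u, hu, rfl⟩ | ⟨h, hd⟩)
    · refine ⟨⟨u, rfl⟩, ?_, ?_⟩
      · rintro a rfl b rfl
        exact .single ⟨rfl, rfl, .inl ⟨hu, rfl⟩⟩
      · rintro a b e rfl _
        exact (e.resolve_right fun h => h.1 hu).2
    · have hd' := Set.disjoint_left.1 hd
      refine ⟨h.nonempty, fun u hu v hv => Relation.TransGen.mono ?_ _ _ (h.connected u hu v hv),
        fun u v e hu hp => h.closed u v (e.resolve_left fun h => hd' hu h.1).2 hu hp⟩
      rintro a b ⟨ha, hb, e⟩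
      exact ⟨ha, hb, .inr ⟨hd' ha, e⟩⟩

theorem MDPGraph.isMEC_isolate_iff (G : MDPGraph V) {F C : Set V} {v : V} (hv : v ∈ C)
    (hF : v ∉ F) : (G.isolate F).IsMEC C ↔ G.IsMECWithout F C := by
  have hno : ∀ U, v ∈ U → ((G.isolate F).IsEC U ↔ G.IsEC U ∧ Disjoint U F) := fun U hU => by
    rw [isEC_isolate_iff]
    refine or_iff_right ?_
    rintro ⟨u, hu, rfl⟩
    rw [Set.mem_singleton_iff] at hU
    exact hF (hU ▸ hu)
  constructor
  · exact fun h => ⟨(hno C hv).1 h.prop, fun U hU hCU => h.2 ((hno U (hCU hv)).2 hU) hCU⟩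
  · exact fun h => ⟨(hno C hv).2 h.prop, fun U hU hCU => h.2 ((hno U (hCU hv)).1 hU) hCU⟩

/-- The winning set of a pair in terms of a labelling of the components. -/
theorem MDPGraph.mem_winningSet_iff (G : MDPGraph V) (p : GRPair V) {lab : V → ℕ}
    (hlab : (G.isolate p.F).IsMECLabelling lab) (v : V) :
    v ∈ G.winningSet p ↔ (v ∉ p.F ∧ lab v ≠ 0) ∧ ∀ S ∈ p.I, ∃ u ∈ S, lab u = lab v := by
  constructor
  · rintro ⟨C, ⟨hC, hI⟩, hv⟩
    have hvF : v ∉ p.F := Set.disjoint_left.1 hC.prop.2 hv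
    have hM := (G.isMEC_isolate_iff hv hvF).2 hC
    have hv0 : lab v ≠ 0 := (hlab.1 v).2 ⟨C, hM, hv⟩
    refine ⟨⟨hvF, hv0⟩, fun S hS => ?_⟩
    obtain ⟨u, huC, huS⟩ := hI S hS
    exact ⟨u, huS, (hlab.2 u v ((hlab.1 u).2 ⟨C, hM, huC⟩) hv0).2 ⟨C, hM, huC, hv⟩⟩
  · rintro ⟨⟨hvF, hv0⟩, hI⟩
    obtain ⟨C, hM, hv⟩ := (hlab.1 v).1 hv0
    have hC := (G.isMEC_isolate_iff hv hvF).1 hM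
    refine ⟨C, ⟨hC, fun S hS => ?_⟩, hv⟩
    obtain ⟨u, huS, hu⟩ := hI S hS
    obtain ⟨C', hM', hu', hv'⟩ := (hlab.2 u v (hu ▸ hv0) hv0).1 hu
    have hC' := (G.isMEC_isolate_iff hv' hvF).1 hM'
    -- Both components contain `v`, so each equals their union.
    have : C = C' := by
      refine hM.eq_of_le ((G.isEC_isolate_iff _ _).2 (.inr ?_)) Set.subset_union_left |>.trans
        (hM'.eq_of_le ((G.isEC_isolate_iff _ _).2 (.inr ?_)) (y := C ∪ C')
          Set.subset_union_right).symm
      all_goals exact ⟨hC.prop.1.union hC'.prop.1 ⟨v, hv, hv'⟩,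
        Set.disjoint_union_left.2 ⟨hC.prop.2, hC'.prop.2⟩⟩
    exact ⟨u, this ▸ hu', huS⟩

variable {n : ℕ}

open Classical in
/-- The edges of `MDPGraph.isolate`. -/
noncomputable def isolateEdges (F : Set (Fin n)) (es : List (Fin n × Fin n)) :
    List (Fin n × Fin n) :=
  ((List.finRange n).filter fun v => v ∈ F).map (fun v => (v, v)) ++ es.filter fun e => e.1 ∉ F

theorem MDPGraph.IsEdgeList.isolate {G : MDPGraph (Fin n)} {es : List (Fin n × Fin n)}
    (h : G.IsEdgeList es) (F : Set (Fin n)) : (G.isolate F).IsEdgeList (isolateEdges F es) := by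
  classical
  refine ⟨?_, fun u v => ?_⟩
  · rw [isolateEdges, List.nodup_append]
    refine ⟨List.Nodup.map (fun a b hab => (Prod.ext_iff.1 hab).1)
      ((List.nodup_finRange n).filter _), h.1.filter _, ?_⟩
    rintro a ha b hb rfl
    simp only [List.mem_map, List.mem_filter, decide_eq_true_eq] at ha hb
    obtain ⟨v, hv, rfl⟩ := ha
    exact hb.2 hv.2
  · simp only [isolateEdges, MDPGraph.isolate, List.mem_append, List.mem_map, List.mem_filter,
      decide_eq_true_eq, h.2, List.mem_finRange, true_and, Prod.mk.injEq]
    constructor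
    · rintro (⟨a, ha, rfl, rfl⟩ | h)
      · exact .inl ⟨ha, rfl⟩
      · exact .inr ⟨h.2, h.1⟩
    · rintro (⟨hu, rfl⟩ | h)
      · exact .inl ⟨v, hu, rfl, rfl⟩
      · exact .inr ⟨h.2, h.1⟩

theorem MDPGraph.IsEdgeList.length_filter_le {G : MDPGraph (Fin n)} {es : List (Fin n × Fin n)}
    (h : G.IsEdgeList es) (p : Fin n → Bool) :
    ((List.finRange n).filter p).length ≤ (es.filter fun e => p e.1).length := by
  rw [← List.length_map (as := es.filter fun e => p e.1) Prod.fst]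
  refine (List.subperm_of_subset ((List.nodup_finRange n).filter _) fun v hv => ?_).length_le
  obtain ⟨u, e⟩ := G.total v
  exact List.mem_map.2 ⟨(v, u), List.mem_filter.2 ⟨(h.2 v u).2 e, (List.mem_filter.1 hv).2⟩, rfl⟩

theorem MDPGraph.IsEdgeList.le_length {G : MDPGraph (Fin n)} {es : List (Fin n × Fin n)}
    (h : G.IsEdgeList es) : n ≤ es.length := by
  simpa using h.length_filter_le fun _ => true

/-- Each new self-loop replaces at least one deleted edge, because every vertex of `F` had a
successor. Hence the bound for `n` vertices and `m` edges still applies. -/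
theorem MDPGraph.IsEdgeList.length_isolateEdges_le {G : MDPGraph (Fin n)}
    {es : List (Fin n × Fin n)} (h : G.IsEdgeList es) (F : Set (Fin n)) :
    (isolateEdges F es).length ≤ es.length := by
  classical
  have h1 := h.length_filter_le fun v => v ∈ F
  have h2 := List.length_eq_length_filter_add (l := es) fun e => decide (e.1 ∈ F)
  simp only [isolateEdges, List.length_append, List.length_map, decide_not] at h1 h2 ⊢
  omega

end Isolate

/-! ### Programs: building the isolated graph and labelling its components. -/

section GraphProgram

theorem length_bits {n : ℕ} (S : Set (Fin n)) : (bits S).length = n := by simp [bits]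

theorem reads_bits_iff {n : ℕ} {f : ℕ → ℕ} {o : ℕ} {S : Set (Fin n)} :
    Reads f o (bits S) ↔ ∀ v : Fin n, f (o + v) = open Classical in if v ∈ S then 1 else 0 := by
  classical
  constructor
  · intro h v
    rw [h v (by rw [length_bits]; exact v.2)]
    simp only [bits, List.getElem_ofFn]
  · intro h i hi
    rw [length_bits] at hi
    rw [h ⟨i, hi⟩]
    simp only [bits, List.getElem_ofFn]

/-- The graph part of the input. -/
structure HoldsGraph {n : ℕ} (G : MDPGraph (Fin n)) (es : List (Fin n × Fin n)) (s : Store) :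
    Prop where
  card : s.nat 0 0 = n
  edges : s.nat 0 1 = es.length
  prob : Reads (s.nat 1) 0 (bits G.VP)
  src : Reads (s.nat 2) 0 (es.map fun e => (e.1 : ℕ))
  tgt : Reads (s.nat 3) 0 (es.map fun e => (e.2 : ℕ))

/-- The input occupies the natural arrays 0 to 6 and the real array 0. Natural work arrays: 10, 13,
14 loop counters; 11 and 12 read positions in the arrays 5 and 6; 20 to 22 the isolated graph; 23
labels; 24 marks on labels; 25 candidates of the current pair; 26 the winning set; 32 to 34 row
offsets. Real work arrays: 10, 11, 12 the linear program; 13 the transition matrix. -/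
theorem HoldsGraph.frame {n : ℕ} {G : MDPGraph (Fin n)} {es : List (Fin n × Fin n)} {s s' : Store}
    (h : HoldsGraph G es s) {A B : List ℕ} (hF : Frame A B s s')
    (hA : 0 ∉ A ∧ 1 ∉ A ∧ 2 ∉ A ∧ 3 ∉ A) : HoldsGraph G es s' := by
  obtain ⟨h0, h1, h2, h3⟩ := hA
  constructor
  · rw [hF.nat 0 h0]; exact h.card
  · rw [hF.nat 0 h0]; exact h.edges
  · rw [hF.nat 1 h1]; exact h.prob
  · rw [hF.nat 2 h2]; exact h.src
  · rw [hF.nat 3 h3]; exact h.tgt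

theorem HoldsGraph.src_getElem {n : ℕ} {G : MDPGraph (Fin n)} {es : List (Fin n × Fin n)}
    {s : Store} (h : HoldsGraph G es s) {i : ℕ} (hi : i < es.length) : s.nat 2 i = es[i].1 := by
  have := h.src i (by simpa using hi)
  rwa [List.getElem_map, zero_add] at this

theorem HoldsGraph.tgt_getElem {n : ℕ} {G : MDPGraph (Fin n)} {es : List (Fin n × Fin n)}
    {s : Store} (h : HoldsGraph G es s) {i : ℕ} (hi : i < es.length) : s.nat 3 i = es[i].2 := by
  have := h.tgt i (by simpa using hi)
  rwa [List.getElem_map, zero_add] at this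

/-- Append the pairs `(e, f)` for which `b` holds to the arrays `21` and `22`, whose length is kept
in the second cell of the array `20`. -/
def pushLoop (N : NExp) (b : BExp) (e f : NExp) : Prog :=
  .for 10 N (.ite b (.seq (.nset 21 (.get 20 (.lit 1)) e) (.seq (.nset 22 (.get 20 (.lit 1)) f)
    (.nset 20 (.lit 1) (.add (.get 20 (.lit 1)) (.lit 1))))) .skip)

theorem wp_pushLoop {α : Type*} {N : NExp} {b : BExp} {e f : NExp} {s : Store}
    {Q : ℕ → Store → Prop} (xs : List α) (P : α → Bool) (g h : α → ℕ) (l l' : List ℕ)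
    (hl : s.nat 20 1 = l.length) (hl' : s.nat 20 1 = l'.length)
    (h21 : Reads (s.nat 21) 0 l) (h22 : Reads (s.nat 22) 0 l')
    (hN : ∀ s', Frame [10, 20, 21, 22] [] s s' → N.eval s' = xs.length)
    (hsem : ∀ i (hi : i < xs.length), ∀ s', Frame [10, 20, 21, 22] [] s s' → s'.nat 10 0 = i →
      (b.Holds s' ↔ P xs[i] = true) ∧ e.eval s' = g xs[i] ∧ f.eval s' = h xs[i])
    (hQ : ∀ t s', t ≤ xs.length * (23 + b.cost + e.cost + f.cost + N.cost) + N.cost + 7 →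
      Frame [10, 20, 21, 22] [] s s' → s'.nat 20 0 = s.nat 20 0 →
      s'.nat 20 1 = l.length + (xs.filter P).length →
      Reads (s'.nat 21) 0 (l ++ (xs.filter P).map g) →
      Reads (s'.nat 22) 0 (l' ++ (xs.filter P).map h) → Q t s') :
    (pushLoop N b e f).wp s Q := by
  refine Prog.wp_for xs.length (13 + b.cost + e.cost + f.cost) (fun i s' =>
    Frame [10, 20, 21, 22] [] s s' ∧ s'.nat 20 0 = s.nat 20 0 ∧
      s'.nat 20 1 = l.length + ((xs.take i).filter P).length ∧
      Reads (s'.nat 21) 0 (l ++ ((xs.take i).filter P).map g) ∧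
      Reads (s'.nat 22) 0 (l' ++ ((xs.take i).filter P).map h))
    (fun i _ s' hi _ => hN s' hi.1) ?_ ?_ ?_
  · refine ⟨(Frame.refl _ _ s).setNat _ _ (by simp), ?_, ?_, ?_, ?_⟩
    · rw [Store.setNat_ne _ _ _ (by decide)]
    · rw [Store.setNat_ne _ _ _ (by decide)]; simpa using hl
    · rw [Store.setNat_ne _ _ _ (by decide)]; simpa using h21
    · rw [Store.setNat_ne _ _ _ (by decide)]; simpa using h22
  · rintro i hi s' ⟨hF, h0, h1, h2, h3⟩ hs
    obtain ⟨hb, he, -⟩ := hsem i hi s' hF hs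
    have htake : xs.take (i + 1) = xs.take i ++ [xs[i]] := List.take_succ_eq_append_getElem hi
    refine Prog.wp_ite (fun hh => Prog.wp_seq (Prog.wp_nset (Prog.wp_seq (Prog.wp_nset
      (Prog.wp_nset ?_))))) (fun hh => Prog.wp_skip ?_)
    · have hP := hb.1 hh
      -- The expression `f` is evaluated only after the write to the array 21, so its value is
      -- needed in that store.
      have hF1 := hF.setNat (a := 21) ((NExp.get 20 (.lit 1)).eval s') (e.eval s') (by simp)
      have hf := (hsem i hi _ hF1 (by rw [Store.setNat_ne _ _ _ (by decide), hs])).2.2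
      have hfil : (xs.take (i + 1)).filter P = (xs.take i).filter P ++ [xs[i]] := by
        rw [htake, List.filter_append, List.filter_cons_of_pos hP, List.filter_nil]
      have e1 : s'.nat 20 1 = (l ++ ((xs.take i).filter P).map g).length := by simp [h1]
      have e2 : s'.nat 20 1 = (l' ++ ((xs.take i).filter P).map h).length := by
        simp [h1, ← hl', hl]
      refine ⟨by simp only [NExp.cost]; omega, ?_, ((hF1.setNat _ _ (by simp)).setNat _ _
        (by simp)).setNat _ _ (by simp), ?_, ?_, ?_, ?_⟩
      · simp [Store.setNat_ne, hs]
      · simp [Store.setNat_ne, Store.setNat_self, h0, NExp.eval]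
      · rw [hfil]
        simp [Store.setNat_ne, Store.setNat_self, h1, NExp.eval, add_assoc]
      · have := h2.snoc (g xs[i])
        rw [← e1, List.append_assoc, ← List.map_singleton, ← List.map_append, ← hfil] at this
        simpa [Store.setNat_ne, Store.setNat_self, NExp.eval, he] using this
      · have := h3.snoc (h xs[i])
        rw [← e2, List.append_assoc, ← List.map_singleton, ← List.map_append, ← hfil] at this
        simp only [NExp.eval] at hf
        simpa [Store.setNat_ne, Store.setNat_self, NExp.eval, hf] using this
    · have hP : ¬ P xs[i] = true := fun hp => hh (hb.2 hp)
      have hfil : (xs.take (i + 1)).filter P = (xs.take i).filter P := by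
        rw [htake, List.filter_append, List.filter_cons_of_neg hP, List.filter_nil,
          List.append_nil]
      refine ⟨by omega, hs, hF.setNat _ _ (by simp), ?_, ?_, ?_, ?_⟩
      all_goals rw [Store.setNat_ne _ _ _ (by decide)]
      · exact h0
      · rw [hfil]; exact h1
      · rw [hfil]; exact h2
      · rw [hfil]; exact h3
  · rintro t s' ht ⟨hF, h0, h1, h2, h3⟩ -
    rw [List.take_length] at h1 h2 h3
    refine hQ t s' (ht.trans (le_of_eq ?_)) hF h0 h1 h2 h3
    ring

/-- Write the graph with the current set `F` isolated into the arrays `20`, `21`, `22`. -/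
def isolateProg : Prog :=
  .seq (.nset 20 (.lit 0) (.var 0)) (.seq (.nset 20 (.lit 1) (.lit 0)) (.seq
    (pushLoop (.var 0) (.natEq (.get 5 (.add (.var 11) (.var 10))) (.lit 1)) (.var 10) (.var 10))
    (pushLoop (.get 0 (.lit 1)) (.natEq (.get 5 (.add (.var 11) (.get 2 (.var 10)))) (.lit 0))
      (.get 2 (.var 10)) (.get 3 (.var 10)))))

theorem wp_isolateProg {n : ℕ} {G : MDPGraph (Fin n)} {es : List (Fin n × Fin n)} {F : Set (Fin n)}
    {s : Store} {Q : ℕ → Store → Prop} (hG : HoldsGraph G es s)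
    (hF : Reads (s.nat 5) (s.nat 11 0) (bits F))
    (hQ : ∀ t s', t ≤ 50 * (n + es.length) + 50 → Frame [10, 20, 21, 22] [] s s' →
      s'.nat 20 0 = n → s'.nat 20 1 = (isolateEdges F es).length →
      Reads (s'.nat 21) 0 ((isolateEdges F es).map fun e => (e.1 : ℕ)) →
      Reads (s'.nat 22) 0 ((isolateEdges F es).map fun e => (e.2 : ℕ)) → Q t s') :
    isolateProg.wp s Q := by
  classical
  rw [reads_bits_iff] at hF
  refine Prog.wp_seq (Prog.wp_nset (Prog.wp_seq (Prog.wp_nset (Prog.wp_seq ?_))))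
  set s₁ := (s.setNat 20 ((NExp.lit 0).eval s) ((NExp.var 0).eval s)) with hs₁
  set s₂ := s₁.setNat 20 ((NExp.lit 1).eval s₁) ((NExp.lit 0).eval s₁) with hs₂
  have hf₂ : Frame [10, 20, 21, 22] [] s s₂ :=
    ((Frame.refl _ _ s).setNat _ _ (by simp)).setNat _ _ (by simp)
  have h20 : s₂.nat 20 0 = n := by
    simp [hs₂, hs₁, Store.setNat_self, NExp.eval, NExp.eval_var, hG.card]
  have h21 : s₂.nat 20 1 = 0 := by simp [hs₂, Store.setNat_self, NExp.eval]
  refine wp_pushLoop (List.finRange n) (fun v => decide (v ∈ F)) (fun v => (v : ℕ))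
    (fun v => (v : ℕ)) [] [] h21 h21 (reads_nil _ _) (reads_nil _ _) ?_ ?_ ?_
  · intro s' h
    rw [NExp.eval_var, h.nat 0 (by decide), hf₂.nat 0 (by decide), hG.card, List.length_finRange]
  · intro i hi s' h hs
    rw [List.length_finRange] at hi
    have h5 : s'.nat 5 = s.nat 5 := (h.nat 5 (by decide)).trans (hf₂.nat 5 (by decide))
    have h11 : s'.nat 11 = s.nat 11 := (h.nat 11 (by decide)).trans (hf₂.nat 11 (by decide))
    have := hF ⟨i, hi⟩
    simp only at this
    simp only [BExp.Holds, NExp.eval, NExp.eval_var, h5, h11, hs, this, List.getElem_finRange]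
    simp
  intro t₁ s₃ ht₁ hf₃ h20' h21' hr1 hr2
  refine wp_pushLoop es (fun e => decide (e.1 ∉ F)) (fun e => (e.1 : ℕ)) (fun e => (e.2 : ℕ)) _ _
    (by simpa using h21') (by simpa using h21') hr1 hr2 ?_ ?_ ?_
  · intro s' h
    rw [NExp.eval, h.nat 0 (by decide), hf₃.nat 0 (by decide), hf₂.nat 0 (by decide), NExp.eval,
      hG.edges]
  · intro i hi s' h hs
    have hf : Frame [10, 20, 21, 22] [] s s' :=
      (hf₂.trans hf₃ (by simp) (by simp)).trans h (by simp) (by simp)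
    have hG' := hG.frame hf (by decide)
    have h5 : s'.nat 5 = s.nat 5 := hf.nat 5 (by decide)
    have h11 : s'.nat 11 = s.nat 11 := hf.nat 11 (by decide)
    simp only [BExp.Holds, NExp.eval, NExp.eval_var, h5, h11, hs, hG'.src_getElem hi,
      hG'.tgt_getElem hi, hF]
    simp
  intro t₂ s₄ ht₂ hf₄ h20'' h21'' hr1' hr2'
  refine hQ _ _ ?_ ((hf₂.trans hf₃ (by simp) (by simp)).trans hf₄ (by simp) (by simp))
    (by rw [h20'', h20', h20]) (by simpa [isolateEdges] using h21'') ?_ ?_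
  · simp only [BExp.cost, NExp.cost, NExp.cost_var, List.length_finRange] at ht₁ ht₂ ⊢
    omega
  · simpa [isolateEdges, Function.comp_def] using hr1'
  · simpa [isolateEdges, Function.comp_def] using hr2'

/-- Compute the labels of the maximal end-components of the graph with `F` isolated. -/
def labelProg (p : Prog) : Prog :=
  .seq isolateProg (.call p [(20, .lit 2), (1, .var 0), (21, .get 20 (.lit 1)),
    (22, .get 20 (.lit 1))] [] (23, .var 0) (0, .lit 0))

theorem wp_labelProg {n : ℕ} {G : MDPGraph (Fin n)} {es : List (Fin n × Fin n)} {F : Set (Fin n)}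
    {p : Prog} {T : ℕ} {s : Store} {Q : ℕ → Store → Prop} (hG : HoldsGraph G es s)
    (hF : Reads (s.nat 5) (s.nat 11 0) (bits F)) (hes : n ≤ es.length)
    (hp : p.RunsIn ((G.isolate F).encode (isolateEdges F es)) T
      fun s => (G.isolate F).IsMECLabelling fun v => s.nat 0 v)
    (hQ : ∀ t s', t ≤ 102 * es.length + T + 70 → Frame [10, 20, 21, 22, 23] [] s s' →
      ((G.isolate F).IsMECLabelling fun v => s'.nat 23 v) → Q t s') :
    (labelProg p).wp s Q := by
  refine Prog.wp_seq (wp_isolateProg hG hF fun t₁ s₁ ht₁ hf h20 h21 hr1 hr2 => ?_)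
  obtain ⟨t₂, s₂, he, ht₂, hlab⟩ := hp
  have hG₁ := hG.frame hf (by decide)
  -- Isolating `F` does not change which vertices are probabilistic, so the array 1 is passed on as
  -- it is.
  have hargs : s₁.args [(20, .lit 2), (1, .var 0), (21, .get 20 (.lit 1)),
      (22, .get 20 (.lit 1))] [] = (G.isolate F).encode (isolateEdges F es) := by
    simp only [Store.args, MDPGraph.encode, List.map_cons, List.map_nil, NExp.eval, NExp.eval_var,
      hG₁.card, h21, Input.mk.injEq, and_true, List.cons.injEq]
    refine ⟨by simp [List.range_succ, h20, h21], ?_, ?_, ?_⟩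
    · simpa [length_bits, MDPGraph.isolate] using reads_zero_iff.1 hG₁.prob
    · simpa using reads_zero_iff.1 hr1
    · simpa using reads_zero_iff.1 hr2
  refine Prog.wp_call ⟨t₂, s₂, hargs ▸ he, ?_⟩
  rw [hargs]
  simp only [NExp.eval, NExp.eval_var, NExp.cost, NExp.cost_var, hG₁.card]
  refine hQ _ _ ?_ ⟨fun a ha => ?_, fun a _ => ?_⟩ ?_
  · simp only [List.map_cons, List.map_nil, List.sum_cons, List.sum_nil, NExp.cost, NExp.cost_var]
    omega
  · have h23 : a ≠ 23 := by rintro rfl; simp at ha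
    rw [← hf.nat a fun h => ha (by simp at h ⊢; tauto)]
    funext i
    simp [Store.ret, h23]
  · rw [← hf.real a (by simp)]
    funext i
    simp [Store.ret]
  · simpa [Store.ret] using hlab

end GraphProgram

/-! ### Programs: the winning set of each pair. -/

section PairProgram

/-- The condition that always holds. -/
def BExp.true : BExp := .natEq (.lit 0) (.lit 0)

theorem BExp.holds_true (s : Store) : BExp.true.Holds s := rfl

theorem BExp.cost_true : BExp.true.cost = 3 := rfl

/-- Set the array `25` to the characteristic vector of the vertices outside of the current set `F`
that have a label. -/
def candidateProg : Prog :=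
  .seq (.for 10 (.var 0) (.ite .true (.nset 25 (.var 10) (.lit 0)) .skip))
    (.for 10 (.var 0) (.ite (.and (.not (.natEq (.get 23 (.var 10)) (.lit 0)))
      (.natEq (.get 5 (.add (.var 11) (.var 10))) (.lit 0))) (.nset 25 (.var 10) (.lit 1)) .skip))

/-- The first pass erases what an earlier pair left in the array 25. The test against `F` is needed
because isolated vertices form components and are labelled too. -/
theorem wp_candidateProg {n : ℕ} {F : Set (Fin n)} {s : Store} {Q : ℕ → Store → Prop}
    (hn : s.nat 0 0 = n) (hF : Reads (s.nat 5) (s.nat 11 0) (bits F))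
    (hQ : ∀ t s', t ≤ 60 * n + 20 → Frame [10, 25] [] s s' →
      (∀ v : Fin n, s'.nat 25 v = 1 ↔ v ∉ F ∧ s.nat 23 v ≠ 0) → Q t s') :
    candidateProg.wp s Q := by
  classical
  rw [reads_bits_iff] at hF
  refine Prog.wp_seq (Prog.wp_condSet n (fun _ => True) id (by decide)
    (fun s' h => by rw [NExp.eval_var, h.nat 0 (by decide), hn])
    (fun i _ s' _ hs => ⟨by simp [BExp.holds_true], hs⟩) fun t₁ s₁ ht₁ hf₁ h1 _ =>
    Prog.wp_condSet n (fun i => s.nat 23 i ≠ 0 ∧ s.nat 5 (s.nat 11 0 + i) = 0) id (by decide)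
    (fun s' h => by rw [NExp.eval_var, h.nat 0 (by decide), hf₁.nat 0 (by decide), hn])
    (fun i _ s' h hs => ⟨?_, hs⟩) fun t₂ s₂ ht₂ hf₂ h2 h3 =>
    hQ _ _ ?_ (hf₁.trans hf₂ (by simp) (by simp)) fun v => ?_)
  · simp only [BExp.Holds, NExp.eval, NExp.eval_var, hs, h.nat 23 (by decide),
      hf₁.nat 23 (by decide), h.nat 5 (by decide), hf₁.nat 5 (by decide), h.nat 11 (by decide),
      hf₁.nat 11 (by decide), ne_eq]
  · simp only [BExp.cost, BExp.cost_true, NExp.cost, NExp.cost_var] at ht₁ ht₂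
    omega
  · by_cases hc : s.nat 23 v ≠ 0 ∧ s.nat 5 (s.nat 11 0 + v) = 0
    · rw [h2 v ⟨v, v.2, hc, rfl⟩]
      have := hF v
      simp only [hc.2] at this
      simp only [true_iff]
      exact ⟨fun h => by simp [h] at this, hc.1⟩
    · rw [h3 v (by rintro ⟨i, _, h, rfl⟩; exact hc h), h1 v ⟨v, v.2, trivial, rfl⟩]
      simp only [zero_ne_one, false_iff]
      rintro ⟨hv, h0⟩
      exact hc ⟨h0, by rw [hF v, if_neg hv]⟩

/-- Remove from the array `25` the vertices whose component misses the set read from the current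
position of the array `6`. -/
def sieveProg : Prog :=
  .seq (.for 10 (.var 0) (.ite .true (.nset 24 (.get 23 (.var 10)) (.lit 0)) .skip)) (.seq
    (.for 10 (.var 0) (.ite (.natEq (.get 6 (.add (.var 12) (.var 10))) (.lit 1))
      (.nset 24 (.get 23 (.var 10)) (.lit 1)) .skip)) (.seq
    (.for 10 (.var 0) (.ite (.natEq (.get 24 (.get 23 (.var 10))) (.lit 0))
      (.nset 25 (.var 10) (.lit 0)) .skip))
    (.nset 12 (.lit 0) (.add (.var 12) (.var 0)))))

/-- Labels may be arbitrarily large, so only the mark cells of labels that occur are cleared; then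
the labels met by `S` are marked and unmarked candidates dropped. This is linear in `n` per set. -/
theorem wp_sieveProg {n : ℕ} {S : Set (Fin n)} {s : Store} {Q : ℕ → Store → Prop}
    (hn : s.nat 0 0 = n) (hS : Reads (s.nat 6) (s.nat 12 0) (bits S))
    (hQ : ∀ t s', t ≤ 100 * n + 50 → Frame [10, 12, 24, 25] [] s s' →
      s'.nat 12 0 = s.nat 12 0 + n →
      (∀ v : Fin n, s'.nat 25 v = 1 ↔
        s.nat 25 v = 1 ∧ ∃ u ∈ S, s.nat 23 u = s.nat 23 v) → Q t s') :
    sieveProg.wp s Q := by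
  classical
  rw [reads_bits_iff] at hS
  refine Prog.wp_seq (Prog.wp_condSet n (fun _ => True) (fun i => s.nat 23 i) (by decide)
    (fun s' h => by rw [NExp.eval_var, h.nat 0 (by decide), hn])
    (fun i _ s' h hs => ⟨by simp [BExp.holds_true], ?_⟩) fun t₁ s₁ ht₁ hf₁ h1 _ =>
    Prog.wp_seq (Prog.wp_condSet n (fun i => s.nat 6 (s.nat 12 0 + i) = 1) (fun i => s.nat 23 i)
    (by decide) (fun s' h => ?_) (fun i _ s' h hs => ?_) fun t₂ s₂ ht₂ hf₂ h2 h3 =>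
    Prog.wp_seq (Prog.wp_condSet n (fun i => s₂.nat 24 (s.nat 23 i) = 0) id
    (by decide) (fun s' h => ?_) (fun i _ s' h hs => ⟨?_, hs⟩) fun t₃ s₃ ht₃ hf₃ h4 h5 =>
    Prog.wp_nset ?_)))
  · simp only [NExp.eval, NExp.eval_var, hs, h.nat 23 (by decide)]
  · rw [NExp.eval_var, h.nat 0 (by decide), hf₁.nat 0 (by decide), hn]
  · simp only [BExp.Holds, NExp.eval, NExp.eval_var, hs, h.nat 23 (by decide),
      hf₁.nat 23 (by decide), h.nat 6 (by decide), hf₁.nat 6 (by decide), h.nat 12 (by decide),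
      hf₁.nat 12 (by decide), and_self]
  · rw [NExp.eval_var, h.nat 0 (by decide), hf₂.nat 0 (by decide), hf₁.nat 0 (by decide), hn]
  · simp only [BExp.Holds, NExp.eval, NExp.eval_var, hs, h.nat 23 (by decide),
      hf₂.nat 23 (by decide), hf₁.nat 23 (by decide), h.nat 24 (by decide)]
  · have hf : Frame [10, 12, 24, 25] [] s s₃ := ((((Frame.refl _ _ s).trans hf₁ (by simp)
      (by simp)).trans hf₂ (by simp) (by simp)).trans hf₃ (by simp) (by simp))
    have h12 : s₃.nat 12 = s.nat 12 := by
      rw [hf₃.nat 12 (by decide), hf₂.nat 12 (by decide), hf₁.nat 12 (by decide)]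
    have h25 : s₂.nat 25 = s.nat 25 := by
      rw [hf₂.nat 25 (by decide), hf₁.nat 25 (by decide)]
    refine hQ _ _ ?_ (hf.setNat _ _ (by simp)) ?_ fun v => ?_
    · simp only [BExp.cost, BExp.cost_true, NExp.cost, NExp.cost_var] at ht₁ ht₂ ht₃ ⊢
      omega
    · simp [Store.setNat_self, NExp.eval, NExp.eval_var, h12, hf.nat 0 (by decide), hn]
    · have hmark : s₂.nat 24 (s.nat 23 v) = 0 ↔ ¬ ∃ u ∈ S, s.nat 23 u = s.nat 23 v := by
        have hiff : (∃ u ∈ S, s.nat 23 u = s.nat 23 v) ↔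
            ∃ i < n, s.nat 6 (s.nat 12 0 + i) = 1 ∧ s.nat 23 i = s.nat 23 v := by
          constructor
          · rintro ⟨u, hu, h⟩
            exact ⟨u, u.2, by rw [hS u, if_pos hu], h⟩
          · rintro ⟨i, hi, h6, h⟩
            have := hS ⟨i, hi⟩
            simp only [h6] at this
            exact ⟨⟨i, hi⟩, by by_contra hc; simp [hc] at this, h⟩
        rw [hiff]
        by_cases hc : ∃ i < n, s.nat 6 (s.nat 12 0 + i) = 1 ∧ s.nat 23 i = s.nat 23 v
        · rw [h2 _ hc]; simp [hc]
        · rw [h3 _ hc, h1 _ ⟨v, v.2, trivial, rfl⟩]; simp [hc]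
      rw [Store.setNat_ne _ _ _ (by decide)]
      by_cases hc : s₂.nat 24 (s.nat 23 v) = 0
      · rw [h4 v ⟨v, v.2, hc, rfl⟩]
        simp [hmark.1 hc]
      · rw [h5 v (by rintro ⟨i, _, h, rfl⟩; exact hc h), h25]
        have := not_not.1 (mt hmark.2 hc)
        simp [this]

/-- Process all sets `I^j` of the current pair. -/
def sievesProg : Prog := .for 14 (.get 4 (.var 13)) sieveProg

theorem length_flatten_bits {n : ℕ} (L : List (Set (Fin n))) :
    (L.map bits).flatten.length = L.length * n := by
  induction L with
  | nil => simp
  | cons S L ih => simp only [List.map_cons, List.flatten_cons, List.length_append, ih, length_bits,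
      List.length_cons]; ring

theorem wp_sievesProg {n : ℕ} {I : List (Set (Fin n))} {s : Store} {Q : ℕ → Store → Prop}
    (hn : s.nat 0 0 = n) (hI : Reads (s.nat 6) (s.nat 12 0) (I.map bits).flatten)
    (hl : s.nat 4 (s.nat 13 0) = I.length)
    (hQ : ∀ t s', t ≤ I.length * (100 * n + 63) + 10 → Frame [10, 12, 14, 24, 25] [] s s' →
      s'.nat 12 0 = s.nat 12 0 + (I.map bits).flatten.length →
      (∀ v : Fin n, s'.nat 25 v = 1 ↔
        s.nat 25 v = 1 ∧ ∀ S ∈ I, ∃ u ∈ S, s.nat 23 u = s.nat 23 v) → Q t s') :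
    sievesProg.wp s Q := by
  refine Prog.wp_for I.length (100 * n + 50) (fun j s' => Frame [10, 12, 14, 24, 25] [] s s' ∧
    s'.nat 12 0 = s.nat 12 0 + j * n ∧ ∀ v : Fin n, s'.nat 25 v = 1 ↔
      s.nat 25 v = 1 ∧ ∀ S ∈ I.take j, ∃ u ∈ S, s.nat 23 u = s.nat 23 v) ?_ ?_ ?_ ?_
  · rintro i _ s' ⟨h, -⟩ -
    simp only [NExp.eval, NExp.eval_var, h.nat 4 (by decide), h.nat 13 (by decide), hl]
  · refine ⟨(Frame.refl _ _ s).setNat _ _ (by simp), ?_, fun v => ?_⟩ <;>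
      simp [Store.setNat_ne]
  · rintro j hj s' ⟨hf, h12, h25⟩ hs
    refine wp_sieveProg (n := n) (S := I[j]) (by rw [hf.nat 0 (by decide), hn]) ?_
      fun t s'' ht hf' h12' h25' => ⟨ht, by rw [hf'.nat 14 (by decide), hs],
        (hf.trans hf' (by simp) (by simp)).setNat _ _ (by simp), ?_, fun v => ?_⟩
    · rw [hf.nat 6 (by decide), h12]
      have := hI
      rw [← List.take_append_drop j I, List.map_append, List.flatten_append, reads_append,
        length_flatten_bits, List.drop_eq_getElem_cons hj, List.map_cons, List.flatten_cons,
        reads_append, List.length_take_of_le hj.le] at this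
      exact this.2.1
    · rw [Store.setNat_ne _ _ _ (by decide), h12', h12]; ring
    · rw [Store.setNat_ne _ _ _ (by decide), h25', h25, hf.nat 23 (by decide),
        List.take_succ_eq_append_getElem hj, and_assoc]
      simp only [List.mem_append, List.mem_singleton, or_imp, forall_and, forall_eq]
  · rintro t s' ht ⟨hf, h12, h25⟩ -
    rw [List.take_length] at h25
    refine hQ t s' (ht.trans ?_) hf (by rw [h12, length_flatten_bits]) h25
    simp only [NExp.cost, NExp.cost_var]
    have : 100 * n + 50 + (1 + 2) + 10 = 100 * n + 63 := by ring
    rw [this]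

/-- Process one pair: add its winning vertices to the set in the array `26`. -/
def pairProg (p : Prog) : Prog :=
  .seq (labelProg p) (.seq candidateProg (.seq sievesProg (.seq
    (.for 10 (.var 0) (.ite (.natEq (.get 25 (.var 10)) (.lit 1)) (.nset 26 (.var 10) (.lit 1))
      .skip))
    (.nset 11 (.lit 0) (.add (.var 11) (.var 0))))))

theorem wp_pairProg {n : ℕ} {G : MDPGraph (Fin n)} {es : List (Fin n × Fin n)} {g : GRPair (Fin n)}
    {p : Prog} {T : ℕ} {s : Store} {Q : ℕ → Store → Prop} (hG : HoldsGraph G es s)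
    (hes : n ≤ es.length) (hF : Reads (s.nat 5) (s.nat 11 0) (bits g.F))
    (hI : Reads (s.nat 6) (s.nat 12 0) (g.I.map bits).flatten)
    (hl : s.nat 4 (s.nat 13 0) = g.I.length)
    (hp : p.RunsIn ((G.isolate g.F).encode (isolateEdges g.F es)) T
      fun s => (G.isolate g.F).IsMECLabelling fun v => s.nat 0 v)
    (hQ : ∀ t s', t ≤ 200 * es.length + T + 120 + g.I.length * (100 * n + 63) →
      Frame [10, 11, 12, 14, 20, 21, 22, 23, 24, 25, 26] [] s s' →
      s'.nat 11 0 = s.nat 11 0 + n → s'.nat 12 0 = s.nat 12 0 + (g.I.map bits).flatten.length →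
      (∀ v : Fin n, s'.nat 26 v = 1 ↔ s.nat 26 v = 1 ∨ v ∈ G.winningSet g) → Q t s') :
    (pairProg p).wp s Q := by
  refine Prog.wp_seq (wp_labelProg hG hF hes hp fun t₁ s₁ ht₁ hf₁ hlab => Prog.wp_seq
    (wp_candidateProg (n := n) (F := g.F) ?_ ?_ fun t₂ s₂ ht₂ hf₂ h25 => Prog.wp_seq
    (wp_sievesProg (n := n) (I := g.I) ?_ ?_ ?_ fun t₃ s₃ ht₃ hf₃ h12 h25' => Prog.wp_seq
    (Prog.wp_condSet n (fun i => s₃.nat 25 i = 1) id (by decide) (fun s' h => ?_)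
    (fun i _ s' h hs => ⟨?_, hs⟩) fun t₄ s₄ ht₄ hf₄ h26 h26' => Prog.wp_nset ?_))))
  · rw [hf₁.nat 0 (by decide), hG.card]
  · rw [hf₁.nat 5 (by decide), hf₁.nat 11 (by decide)]; exact hF
  · rw [hf₂.nat 0 (by decide), hf₁.nat 0 (by decide), hG.card]
  · rw [hf₂.nat 6 (by decide), hf₁.nat 6 (by decide), hf₂.nat 12 (by decide),
      hf₁.nat 12 (by decide)]
    exact hI
  · rw [hf₂.nat 4 (by decide), hf₁.nat 4 (by decide), hf₂.nat 13 (by decide),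
      hf₁.nat 13 (by decide)]
    exact hl
  · rw [NExp.eval_var, h.nat 0 (by decide), hf₃.nat 0 (by decide), hf₂.nat 0 (by decide),
      hf₁.nat 0 (by decide), hG.card]
  · simp only [BExp.Holds, NExp.eval, NExp.eval_var, hs, h.nat 25 (by decide)]
  · have hf : Frame [10, 11, 12, 14, 20, 21, 22, 23, 24, 25, 26] [] s s₄ :=
      (((((Frame.refl _ _ s).trans hf₁ (by simp) (by simp)).trans hf₂ (by simp) (by simp)).trans hf₃
        (by simp) (by simp)).trans hf₄ (by simp) (by simp))
    have h11 : s₄.nat 11 = s.nat 11 := by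
      rw [hf₄.nat 11 (by decide), hf₃.nat 11 (by decide), hf₂.nat 11 (by decide),
        hf₁.nat 11 (by decide)]
    refine hQ _ _ ?_ (hf.setNat _ _ (by simp)) ?_ ?_ fun v => ?_
    · simp only [BExp.cost, NExp.cost, NExp.cost_var] at ht₄ ⊢
      omega
    · simp [Store.setNat_self, NExp.eval, NExp.eval_var, h11, hf.nat 0 (by decide), hG.card]
    · rw [Store.setNat_ne _ _ _ (by decide), hf₄.nat 12 (by decide), h12, hf₂.nat 12 (by decide),
        hf₁.nat 12 (by decide)]
    · have hw : s₃.nat 25 v = 1 ↔ v ∈ G.winningSet g := by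
        rw [h25', h25, hf₂.nat 23 (by decide), G.mem_winningSet_iff g hlab]
      rw [Store.setNat_ne _ _ _ (by decide), ← hw]
      by_cases hc : s₃.nat 25 v = 1
      · rw [h26 v ⟨v, v.2, hc, rfl⟩]; simp [hc]
      · rw [h26' v (by rintro ⟨i, _, h, rfl⟩; exact hc h), hf₃.nat 26 (by decide),
          hf₂.nat 26 (by decide), hf₁.nat 26 (by decide)]
        simp [hc]

/-- Process all pairs. -/
def pairsProg (p : Prog) : Prog := .for 13 (.get 0 (.lit 2)) (pairProg p)

/-- The generalized Rabin pairs of the input. -/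
structure HoldsPairs {n : ℕ} (GR : List (GRPair (Fin n))) (s : Store) : Prop where
  card : s.nat 0 2 = GR.length
  len : Reads (s.nat 4) 0 (GR.map fun p => p.I.length)
  F : Reads (s.nat 5) 0 (GR.map fun p => bits p.F).flatten
  I : Reads (s.nat 6) 0 (GR.map fun p => (p.I.map bits).flatten).flatten

theorem sum_range_getD (L : List ℕ) : ∑ i ∈ Finset.range L.length, L.getD i 0 = L.sum := by
  induction L with
  | nil => simp
  | cons a L ih =>
    rw [List.length_cons, Finset.sum_range_succ', List.sum_cons, ← ih, add_comm]
    simp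

/-- The sets of all pairs are stored consecutively. The invariant says that the read positions stand
at the data of the remaining pairs, so no position has to be computed by multiplication. -/
theorem wp_pairsProg {n : ℕ} {G : MDPGraph (Fin n)} {es : List (Fin n × Fin n)}
    {GR : List (GRPair (Fin n))} {p : Prog} {T : ℕ} {s : Store} {Q : ℕ → Store → Prop}
    (hn : 0 < n) (hG : HoldsGraph G es s) (hes : n ≤ es.length) (hGR : HoldsPairs GR s)
    (h11 : s.nat 11 0 = 0) (h12 : s.nat 12 0 = 0) (h26 : ∀ v : Fin n, s.nat 26 v = 0)
    (hp : ∀ g ∈ GR, p.RunsIn ((G.isolate g.F).encode (isolateEdges g.F es)) T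
      fun s => (G.isolate g.F).IsMECLabelling fun v => s.nat 0 v)
    (hQ : ∀ t s', t ≤ GR.length * (333 * es.length + T) + 163 * (n * sumLen GR) + 9 →
      Frame [10, 11, 12, 13, 14, 20, 21, 22, 23, 24, 25, 26] [] s s' →
      (∀ v : Fin n, s'.nat 26 v = 1 ↔ v ∈ G.winning GR) → Q t s') :
    (pairsProg p).wp s Q := by
  let ℓ : ℕ → ℕ := fun i => (GR.map fun p => p.I.length).getD i 0
  refine Prog.wp_for_sum GR.length
    (fun i => 200 * es.length + T + 120 + ℓ i * (100 * n + 63))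
    (fun i s' => Frame [10, 11, 12, 13, 14, 20, 21, 22, 23, 24, 25, 26] [] s s' ∧
      Reads (s.nat 5) (s'.nat 11 0) ((GR.drop i).map fun p => bits p.F).flatten ∧
      Reads (s.nat 6) (s'.nat 12 0) ((GR.drop i).map fun p => (p.I.map bits).flatten).flatten ∧
      ∀ v : Fin n, s'.nat 26 v = 1 ↔ ∃ g ∈ GR.take i, v ∈ G.winningSet g) ?_ ?_ ?_ ?_
  · rintro i _ s' ⟨h, -⟩ -
    simp only [NExp.eval, h.nat 0 (by decide), hGR.card]
  · refine ⟨(Frame.refl _ _ s).setNat _ _ (by simp), ?_, ?_, fun v => ?_⟩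
    · rw [Store.setNat_ne _ _ _ (by decide), h11]; exact hGR.F
    · rw [Store.setNat_ne _ _ _ (by decide), h12]; exact hGR.I
    · rw [Store.setNat_ne _ _ _ (by decide), h26]; simp
  · rintro i hi s' ⟨hf, hF, hI, hW⟩ hs
    have hd := List.drop_eq_getElem_cons hi
    rw [hd, List.map_cons, List.flatten_cons, reads_append] at hF hI
    have hlen : s.nat 4 i = GR[i].I.length := by
      have := hGR.len i (by simpa using hi)
      rwa [List.getElem_map, zero_add] at this
    refine wp_pairProg (g := GR[i]) (hG.frame hf (by decide)) hes ?_ ?_ ?_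
      (hp _ (List.getElem_mem hi)) fun t s'' ht hf' h11' h12' h26' => ⟨?_, ?_, ?_, ?_, ?_, ?_⟩
    · rw [hf.nat 5 (by decide)]; exact hF.1
    · rw [hf.nat 6 (by decide)]; exact hI.1
    · rw [hf.nat 4 (by decide), hs, hlen]
    · have : ℓ i = GR[i].I.length := by simp [ℓ, hi]
      rw [this]; exact ht
    · rw [hf'.nat 13 (by decide), hs]
    · exact (hf.trans hf' (by simp) (by simp)).setNat _ _ (by simp)
    · rw [Store.setNat_ne _ _ _ (by decide), h11']
      have := hF.2
      rwa [length_bits] at this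
    · rw [Store.setNat_ne _ _ _ (by decide), h12']; exact hI.2
    · intro v
      rw [Store.setNat_ne _ _ _ (by decide), h26', hW, List.take_succ_eq_append_getElem hi]
      simp only [List.mem_append, List.mem_singleton, or_and_right, exists_or, exists_eq_left]
  · rintro t s' ht ⟨hf, -, -, hW⟩ -
    rw [List.take_length] at hW
    refine hQ t s' (ht.trans ?_) hf hW
    have hsum : ∑ i ∈ Finset.range GR.length, ℓ i = sumLen GR := by
      rw [sumLen, ← sum_range_getD, List.length_map]
    -- Positivity of `n` absorbs `63 * ℓ i` into a multiple of `n * ℓ i`, and the constant overhead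
    -- into a multiple of the number of edges.
    have hle : ∀ i ∈ Finset.range GR.length,
        200 * es.length + T + 120 + ℓ i * (100 * n + 63) + (NExp.get 0 (.lit 2)).cost + 10 ≤
          (333 * es.length + T) + 163 * n * ℓ i := fun i _ => by
      have h1 : ℓ i ≤ n * ℓ i := Nat.le_mul_of_pos_left _ hn
      have h2 : ℓ i * (100 * n + 63) = 100 * (n * ℓ i) + 63 * ℓ i := by ring
      have h3 : 163 * n * ℓ i = 163 * (n * ℓ i) := by ring
      simp only [NExp.cost]
      omega
    refine (Nat.add_le_add_right (Nat.add_le_add_right (Finset.sum_le_sum hle) _) _).trans ?_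
    rw [Finset.sum_add_distrib, Finset.sum_const, Finset.card_range, ← Finset.mul_sum, hsum,
      smul_eq_mul, mul_assoc 163]
    simp only [NExp.cost]
    omega

end PairProgram

/-! ### Programs: building and solving the linear program; the total running time. -/

section LinProgProgram

theorem eq_of_mul_add_eq {n u v u' v' : ℕ} (hv : v < n) (hv' : v' < n)
    (h : u * n + v = u' * n + v') : u = u' ∧ v = v' := by
  have hn : 0 < n := by omega
  have h1 := congrArg (· / n) h
  have h2 := congrArg (· % n) h
  simp only [Nat.mul_add_mod_self_right, Nat.mod_eq_of_lt hv, Nat.mod_eq_of_lt hv'] at h2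
  rw [h2] at h
  exact ⟨Nat.eq_of_mul_eq_mul_right hn (by omega), h2⟩

/-- Tabulate the multiples of the number of vertices in the array `32`. -/
def multiplesProg : Prog :=
  .seq (.nset 33 (.lit 0) (.lit 0)) (.for 10 (.var 0) (.seq (.nset 32 (.var 10) (.var 33))
    (.nset 33 (.lit 0) (.add (.var 33) (.var 0)))))

/-- The machine does not multiply natural numbers; this table of row starts, built by repeated
addition, gives constant-time access to a dense matrix. -/
theorem wp_multiplesProg {n : ℕ} {s : Store} {Q : ℕ → Store → Prop} (hn : s.nat 0 0 = n)
    (hQ : ∀ t s', t ≤ 30 * n + 20 → Frame [10, 32, 33] [] s s' →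
      (∀ v < n, s'.nat 32 v = v * n) → Q t s') : multiplesProg.wp s Q := by
  refine Prog.wp_seq (Prog.wp_nset (Prog.wp_for n 12 (fun i s' => Frame [10, 32, 33] [] s s' ∧
    s'.nat 33 0 = i * n ∧ ∀ v < i, s'.nat 32 v = v * n) ?_ ?_ ?_ ?_))
  · rintro i _ s' ⟨h, -⟩ -
    rw [NExp.eval_var, h.nat 0 (by decide), hn]
  · exact ⟨((Frame.refl _ _ s).setNat _ _ (by simp)).setNat _ _ (by simp),
      by simp [Store.setNat_ne, Store.setNat_self, NExp.eval], by simp⟩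
  · rintro i hi s' ⟨hf, h33, h32⟩ hs
    refine Prog.wp_seq (Prog.wp_nset (Prog.wp_nset ⟨?_, ?_, ((hf.setNat _ _ (by simp)).setNat _ _
      (by simp)).setNat _ _ (by simp), ?_, fun v hv => ?_⟩))
    · simp only [NExp.cost, NExp.cost_var]; omega
    · simp [Store.setNat_ne, hs]
    · simp [Store.setNat_ne, Store.setNat_self, NExp.eval, NExp.eval_var, h33,
        hf.nat 0 (by decide), hn]
      ring
    · rw [Store.setNat_ne _ _ _ (by decide), Store.setNat_ne _ _ _ (by decide), Store.setNat_self,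
        NExp.eval_var, hs]
      rcases Nat.lt_succ_iff_lt_or_eq.1 hv with h | rfl
      · rw [Function.update_of_ne h.ne, h32 v h]
      · rw [Function.update_self, NExp.eval_var, h33]
  · rintro t s' ht ⟨hf, -, h32⟩ -
    refine hQ _ _ ?_ hf h32
    simp only [NExp.cost, NExp.cost_var] at ht ⊢
    omega

/-- Tabulate the transition probabilities as a dense matrix in the real array `13`. -/
def matrixProg : Prog :=
  .for 10 (.get 0 (.lit 1)) (.rset 13 (.add (.get 32 (.get 2 (.var 10))) (.get 3 (.var 10)))
    (.get 0 (.var 10)))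

variable {n : ℕ} {M : MDP (Fin n)} {W : Set (Fin n)} {es : List (Fin n × Fin n)} {s : Store}
  {Q : ℕ → Store → Prop}

theorem wp_matrixProg (hG : HoldsGraph M.toMDPGraph es s) (hes : M.IsEdgeList es)
    (h32 : ∀ v < n, s.nat 32 v = v * n) (h13 : ∀ j, s.real 13 j = 0)
    (hprob : Reads (s.real 0) 0 (es.map M.prob))
    (hQ : ∀ t s', t ≤ 30 * es.length + 20 → Frame [10] [13] s s' →
      (∀ u v : Fin n, s'.real 13 (u * n + v) = M.prob (u, v)) → Q t s') : matrixProg.wp s Q := by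
  have hf : ∀ i (hi : i < es.length), s.nat 32 (s.nat 2 i) + s.nat 3 i =
      es[i].1 * n + es[i].2 := fun i hi => by
    rw [hG.src_getElem hi, hG.tgt_getElem hi, h32 _ (es[i].1).2]
  refine Prog.wp_fillReal (a := 13) es.length 12 (fun i => s.nat 32 (s.nat 2 i) + s.nat 3 i)
    (fun i => s.real 0 i) ?_ ?_ ?_ ?_
  · intro i hi j hj hij
    rw [hf i hi, hf j hj] at hij
    obtain ⟨h1, h2⟩ := eq_of_mul_add_eq (es[i].2).2 (es[j].2).2 hij
    exact (hes.1.getElem_inj_iff).1 (Prod.ext (Fin.ext h1) (Fin.ext h2))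
  · intro s' h
    rw [NExp.eval, h.nat 0 (by decide), NExp.eval, hG.edges]
  · intro i hi s' h hs
    refine Prog.wp_rset ⟨?_, ?_⟩
    · simp only [NExp.cost, RExp.cost, NExp.cost_var]; omega
    · simp only [NExp.eval, RExp.eval, NExp.eval_var, hs, h.nat 32 (by decide), h.nat 2 (by decide),
        h.nat 3 (by decide), h.real 0 (by decide)]
  · intro t s' ht hfr h1 h2
    refine hQ t s' ?_ hfr fun u v => ?_
    · simp only [NExp.cost] at ht
      omega
    · by_cases huv : (u, v) ∈ es
      · obtain ⟨i, hi, he⟩ := List.getElem_of_mem huv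
        have h3 := h1 i hi
        have h4 := hprob i (by simpa using hi)
        rw [List.getElem_map, zero_add] at h4
        rwa [hf i hi, h4, he] at h3
      -- The cell of a non-edge is never written and still holds the initial zero, which is the
      -- right probability; the matrix needs no initialization.
      · rw [h2 _ fun i hi => ?_, h13, MDP.prob]
        · split_ifs with hp
          · have : ¬ M.E u v := fun e => huv ((hes.2 u v).2 e)
            rw [M.edge_iff ⟨u, hp⟩ v, not_lt, nonpos_iff_eq_zero] at this
            simp [this]
          · rfl
        · rw [hf i hi]
          intro h
          obtain ⟨h1, h2⟩ := eq_of_mul_add_eq (es[i].2).2 v.2 h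
          have : es[i] = (u, v) := Prod.ext (Fin.ext h1) (Fin.ext h2)
          exact huv (this ▸ List.getElem_mem hi)

/-- Subtract the coefficient of the vertex in the variable `14` for the current edge from zero. -/
def coeffProg : Prog :=
  .ite (.natEq (.get 26 (.get 2 (.var 10))) (.lit 1))
    (.rset 10 (.add (.var 34) (.var 14)) (.sub .zero .zero))
    (.ite (.natEq (.get 1 (.get 2 (.var 10))) (.lit 1))
      (.rset 10 (.add (.var 34) (.var 14))
        (.sub .zero (.get 13 (.add (.get 32 (.get 2 (.var 10))) (.var 14)))))
      (.ite (.natEq (.var 14) (.get 3 (.var 10)))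
        (.rset 10 (.add (.var 34) (.var 14)) (.sub .zero .one))
        (.rset 10 (.add (.var 34) (.var 14)) (.sub .zero .zero))))

/-- The data from which the linear program is built. -/
structure HoldsTables (M : MDP (Fin n)) (W : Set (Fin n)) (es : List (Fin n × Fin n)) (s : Store) :
    Prop extends HoldsGraph M.toMDPGraph es s where
  target : ∀ v : Fin n, s.nat 26 v = 1 ↔ v ∈ W
  multiples : ∀ v < n, s.nat 32 v = v * n
  matrix : ∀ u v : Fin n, s.real 13 (u * n + v) = M.prob (u, v)

theorem HoldsTables.frame {s' : Store} (h : HoldsTables M W es s) {A B : List ℕ}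
    (hF : Frame A B s s') (hA : 0 ∉ A ∧ 1 ∉ A ∧ 2 ∉ A ∧ 3 ∉ A ∧ 26 ∉ A ∧ 32 ∉ A) (hB : 13 ∉ B) :
    HoldsTables M W es s' where
  toHoldsGraph := h.toHoldsGraph.frame hF ⟨hA.1, hA.2.1, hA.2.2.1, hA.2.2.2.1⟩
  target := by rw [hF.nat 26 hA.2.2.2.2.1]; exact h.target
  multiples := by rw [hF.nat 32 hA.2.2.2.2.2]; exact h.multiples
  matrix := by rw [hF.real 13 hB]; exact h.matrix

theorem HoldsTables.prob_iff (h : HoldsTables M W es s) (v : Fin n) :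
    s.nat 1 v = 1 ↔ v ∈ M.VP := by
  classical
  have := reads_bits_iff.1 h.prob v
  rw [zero_add] at this
  rw [this]
  split_ifs with hv <;> simp [hv]

theorem wp_coeffProg (h : HoldsTables M W es s) {i : ℕ} (hi : i < es.length)
    (hs : s.nat 10 0 = i) (v : Fin n) (hv : s.nat 14 0 = v)
    (hQ : ∀ t, t ≤ 40 →
      Q t (s.setReal 10 (s.nat 34 0 + v) (0 - M.reachCoeff W es[i] v))) :
    coeffProg.wp s Q := by
  have hsrc := h.src_getElem hi
  have h32 := h.multiples es[i].1 (es[i].1).2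
  refine Prog.wp_ite (fun hb => Prog.wp_rset ?_) (fun hb => Prog.wp_ite (fun hc => Prog.wp_rset ?_)
    (fun hc => Prog.wp_ite (fun hd => Prog.wp_rset ?_) (fun hd => Prog.wp_rset ?_)))
  all_goals
    simp only [BExp.Holds, NExp.eval, NExp.eval_var, hs, hv, hsrc, h.target, h.prob_iff,
      h.tgt_getElem hi, Fin.val_inj, h32, RExp.eval, h.matrix] at *
    simp only [BExp.cost, NExp.cost, NExp.cost_var, RExp.cost]
  · rw [show M.reachCoeff W es[i] v = 0 by simp [MDP.reachCoeff, hb]] at hQ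
    exact hQ _ (by norm_num)
  · rw [show M.reachCoeff W es[i] v = M.prob (es[i].1, v) by simp [MDP.reachCoeff, hb, hc]] at hQ
    exact hQ _ (by norm_num)
  · rw [show M.reachCoeff W es[i] v = 1 by simp [MDP.reachCoeff, hb, hc, hd]] at hQ
    exact hQ _ (by norm_num)
  · rw [show M.reachCoeff W es[i] v = 0 by simp [MDP.reachCoeff, hb, hc, hd]] at hQ
    exact hQ _ (by norm_num)

/-- Write one row of the linear program. -/
def rowProg : Prog :=
  .seq (.for 14 (.var 0) coeffProg) (.seq
    (.rset 10 (.add (.var 34) (.get 2 (.var 10)))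
      (.add (.get 10 (.add (.var 34) (.get 2 (.var 10)))) .one)) (.seq
    (.ite (.natEq (.get 26 (.get 2 (.var 10))) (.lit 1)) (.rset 11 (.var 10) .one)
      (.rset 11 (.var 10) .zero))
    (.nset 34 (.lit 0) (.add (.var 34) (.var 0)))))

theorem wp_rowProg (h : HoldsTables M W es s) {i : ℕ} (hi : i < es.length)
    (hs : s.nat 10 0 = i) (h34 : s.nat 34 0 = i * n)
    (hQ : ∀ t s', t ≤ 60 * n + 60 → Frame [14, 34] [10, 11] s s' → s'.nat 34 0 = (i + 1) * n →
      (∀ v : Fin n, s'.real 10 (i * n + v) = (M.reachLP W es).A ⟨i, hi⟩ v) →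
      (∀ j < i * n, s'.real 10 j = s.real 10 j) →
      s'.real 11 = Function.update (s.real 11) i ((M.reachLP W es).b ⟨i, hi⟩) → Q t s') :
    rowProg.wp s Q := by
  classical
  let val : ℕ → ℝ := fun j => if hj : j < n then 0 - M.reachCoeff W es[i] ⟨j, hj⟩ else 0
  refine Prog.wp_seq (Prog.wp_fillReal (a := 10) n 40 (fun v => i * n + v) val
    (fun _ _ _ _ h => by simpa using h) (fun s' hf => ?_) (fun j hj s' hf hs' => ?_)
    fun t₁ s₁ ht₁ hf₁ h1 h2 => ?_)
  · rw [NExp.eval_var, hf.nat 0 (by decide), h.card]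
  · refine wp_coeffProg (h.frame hf (by decide) (by decide)) hi (by rw [hf.nat 10 (by decide), hs])
      ⟨j, hj⟩ hs' fun t ht => ⟨ht, ?_⟩
    rw [hf.nat 34 (by decide), h34]
    simp [val, hj]
  have hT := h.frame hf₁ (by decide) (by decide)
  have hs₁ : s₁.nat 10 0 = i := by rw [hf₁.nat 10 (by decide), hs]
  have h34₁ : s₁.nat 34 0 = i * n := by rw [hf₁.nat 34 (by decide), h34]
  have hpos : (NExp.add (.var 34) (.get 2 (.var 10))).eval s₁ = i * n + es[i].1 := by
    simp only [NExp.eval, NExp.eval_var, hs₁, h34₁, hT.src_getElem hi]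
  refine Prog.wp_seq (Prog.wp_rset ?_)
  simp only [RExp.eval, hpos]
  set s₂ := s₁.setReal 10 (i * n + es[i].1) (s₁.real 10 (i * n + es[i].1) + 1) with hs₂
  have hf₂ : Frame [14, 34] [10, 11] s s₂ :=
    ((Frame.refl _ _ s).trans hf₁ (by simp) (by simp)).setReal _ _ (by simp)
  have hT₂ := h.frame hf₂ (by decide) (by decide)
  -- The loop wrote the negated coefficients; the single addition in the source column supplies the
  -- remaining summand, also for self-loops.
  have hrow : ∀ v : Fin n, s₂.real 10 (i * n + v) = (M.reachLP W es).A ⟨i, hi⟩ v := fun v => by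
    have hv := h1 v v.2
    have hval : val v = 0 - M.reachCoeff W es[i] v := by simp [val]
    rw [hs₂, Store.setReal_self]
    simp only [MDP.reachLP]
    by_cases hc : v = es[i].1
    · rw [← hc, Function.update_self, hv, hval]
      simp only [Fin.getElem_fin, ← hc, if_true]
      ring
    · rw [Function.update_of_ne (by simpa [Fin.val_inj] using hc), hv, hval]
      simp only [Fin.getElem_fin, hc, if_false]
  have hold : ∀ j < i * n, s₂.real 10 j = s.real 10 j := fun j hj => by
    rw [hs₂, Store.setReal_self, Function.update_of_ne (by omega), h2 j fun v _ => by omega]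
  have h11 : s₂.real 11 = s.real 11 := by
    rw [hs₂, Store.setReal_ne _ _ _ (by decide), hf₁.real 11 (by decide)]
  have hfin : ∀ t, t ≤ 60 * n + 60 → Q t ((s₂.setReal 11 i ((M.reachLP W es).b ⟨i, hi⟩)).setNat 34 0
      ((i + 1) * n)) := fun t ht => by
    refine hQ t _ ht ((hf₂.setReal _ _ (by simp)).setNat _ _ (by simp)) ?_ ?_ ?_ ?_
    · simp [Store.setNat_self]
    · intro v
      rw [Store.setNat_real, Store.setReal_ne _ _ _ (by decide), hrow v]
    · intro j hj
      rw [Store.setNat_real, Store.setReal_ne _ _ _ (by decide), hold j hj]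
    · rw [Store.setNat_real, Store.setReal_self, h11]
  have hs₂' : s₂.nat 10 0 = i := hs₁
  have h34₂ : s₂.nat 34 0 + s₂.nat 0 0 = (i + 1) * n := by
    rw [hT₂.card, show s₂.nat 34 0 = i * n from h34₁]; ring
  refine Prog.wp_seq (Prog.wp_ite (fun hb => Prog.wp_rset (Prog.wp_nset ?_))
    (fun hb => Prog.wp_rset (Prog.wp_nset ?_)))
  all_goals
    simp only [BExp.Holds, NExp.eval, NExp.eval_var, hs₂', hT₂.src_getElem hi, hT₂.target] at hb
    have hbv : (M.reachLP W es).b ⟨i, hi⟩ = if es[i].1 ∈ W then 1 else 0 := rfl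
    simp only [hb, if_true, if_false] at hbv
    rw [hbv] at hfin
    simp only [NExp.eval, NExp.eval_var, RExp.eval, hs₂', Store.setReal_nat, h34₂]
    refine hfin _ ?_
    simp only [BExp.cost, NExp.cost, NExp.cost_var, RExp.cost] at ht₁ ⊢
    omega

/-- Build and solve the linear program. -/
def lpProg (p : Prog) : Prog :=
  .seq multiplesProg (.seq matrixProg (.seq (.nset 34 (.lit 0) (.lit 0)) (.seq
    (.for 10 (.get 0 (.lit 1)) rowProg) (.seq (.for 10 (.var 0) (.rset 12 (.var 10) .one))
    (.call p [(0, .lit 2)] [(10, .var 34), (11, .get 0 (.lit 1)), (12, .var 0)] (0, .lit 0)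
      (0, .var 0))))))

/-- After the last row the running offset in the array 34 equals `m * n`, the length of the matrix
to be passed to the solver. -/
theorem wp_lpProg {p : Prog} {T : ℕ} (hG : HoldsGraph M.toMDPGraph es s) (hes : M.IsEdgeList es)
    (h13 : ∀ j, s.real 13 j = 0) (hprob : Reads (s.real 0) 0 (es.map M.prob))
    (h26 : ∀ v : Fin n, s.nat 26 v = 1 ↔ v ∈ W)
    (hp : p.RunsIn (M.reachLP W es).encode T fun s =>
      (M.reachLP W es).IsOptimal fun v => s.real 0 v)
    (hQ : ∀ t s', t ≤ 120 * (n * es.length + n + es.length) + T + 200 →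
      ((M.reachLP W es).IsOptimal fun v => s'.real 0 v) → Q t s') :
    (lpProg p).wp s Q := by
  refine Prog.wp_seq (wp_multiplesProg hG.card fun t₁ s₁ ht₁ hf₁ h32 => Prog.wp_seq
    (wp_matrixProg (hG.frame hf₁ (by decide)) hes h32 (by rwa [hf₁.real 13 (by simp)])
    (by rwa [hf₁.real 0 (by simp)]) fun t₂ s₂ ht₂ hf₂ hm => Prog.wp_seq (Prog.wp_nset
    (Prog.wp_seq ?_))))
  have hf₂' : Frame [10, 32, 33] [13] s s₂ :=
    ((Frame.refl _ _ s).trans hf₁ (by simp) (by simp)).trans hf₂ (by simp) (by simp)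
  have hT₂ : HoldsTables M W es s₂ :=
    { hG.frame hf₂' (by decide) with
      target := by rw [hf₂'.nat 26 (by decide)]; exact h26
      multiples := by rw [hf₂.nat 32 (by decide)]; exact h32
      matrix := hm }
  refine Prog.wp_for es.length (60 * n + 60) (fun i s' => Frame [10, 14, 34] [10, 11] s₂ s' ∧
    s'.nat 34 0 = i * n ∧ ∀ e (he : e < es.length), e < i →
      (∀ v : Fin n, s'.real 10 (e * n + v) = (M.reachLP W es).A ⟨e, he⟩ v) ∧
      s'.real 11 e = (M.reachLP W es).b ⟨e, he⟩) ?_ ?_ ?_ ?_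
  · rintro i _ s' ⟨h, -⟩ -
    rw [NExp.eval, h.nat 0 (by decide), NExp.eval, hT₂.edges]
  · refine ⟨((Frame.refl _ _ s₂).setNat _ _ (by simp)).setNat _ _ (by simp), ?_, by simp⟩
    simp [Store.setNat_ne, Store.setNat_self, NExp.eval]
  · rintro i hi s' ⟨hf, h34, hrows⟩ hs
    refine wp_rowProg (hT₂.frame hf (by decide) (by decide)) hi hs h34
      fun t s'' ht hf' h34' hrow hold hb => ⟨ht, by rw [hf'.nat 10 (by decide), hs],
        (hf.trans hf' (by simp) (by simp)).setNat _ _ (by simp), ?_, fun e he hei => ?_⟩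
    · rw [Store.setNat_ne _ _ _ (by decide), h34']
    · rw [Store.setNat_real, hb]
      rcases Nat.lt_succ_iff_lt_or_eq.1 hei with h | rfl
      · obtain ⟨hr1, hr2⟩ := hrows e he h
        refine ⟨fun v => ?_, by rw [Function.update_of_ne h.ne, hr2]⟩
        rw [← hr1 v, hold]
        calc e * n + v < e * n + n := by omega
          _ = (e + 1) * n := by ring
          _ ≤ i * n := Nat.mul_le_mul_right _ h
      · exact ⟨hrow, by rw [Function.update_self]⟩
  rintro t₃ s₃ ht₃ ⟨hf₃, h34, hrows⟩ -
  refine Prog.wp_seq (Prog.wp_fillReal (a := 12) n 4 id (fun _ => 1) (fun _ _ _ _ h => h)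
    (fun s' hf => by rw [NExp.eval_var, hf.nat 0 (by decide), hf₃.nat 0 (by decide), hT₂.card])
    (fun j _ s' _ hs => Prog.wp_rset ⟨by simp only [NExp.cost_var, RExp.cost]; omega, by
      simp only [NExp.eval_var, hs, RExp.eval, id]⟩) fun t₄ s₄ ht₄ hf₄ hc _ => ?_)
  have hG₄ := (hT₂.toHoldsGraph.frame hf₃ (by decide)).frame hf₄ (by decide)
  have h34₄ : s₄.nat 34 0 = es.length * n := by rw [hf₄.nat 34 (by decide), h34]
  obtain ⟨t₅, s₅, he, ht₅, hopt⟩ := hp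
  have hargs : s₄.args [(0, .lit 2)] [(10, .var 34), (11, .get 0 (.lit 1)), (12, .var 0)] =
      (M.reachLP W es).encode := by
    simp only [Store.args, LinProg.encode, List.map_cons, List.map_nil, NExp.eval, NExp.eval_var,
      hG₄.card, hG₄.edges, h34₄, Input.mk.injEq, and_true, List.cons.injEq]
    refine ⟨by simp [List.range_succ, hG₄.card, hG₄.edges], ?_, ?_, ?_⟩
    · have : (fun i : Fin es.length => List.ofFn ((M.reachLP W es).A i)) =
          fun i : Fin es.length => List.ofFn fun v : Fin n => s₄.real 10 (i * n + v) := by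
        funext i
        congr 1
        funext v
        rw [hf₄.real 10 (by decide), (hrows i i.2 i.2).1 v]
      rw [this, ← List.ofFn_mul (f := fun j : Fin (es.length * n) => s₄.real 10 j)]
      exact List.ext_getElem (by simp) fun i _ _ => by simp
    · refine List.ext_getElem (by simp) fun i hi _ => ?_
      have hi' : i < es.length := by simpa using hi
      simp only [List.getElem_map, List.getElem_range, List.getElem_ofFn]
      rw [hf₄.real 11 (by decide), (hrows i hi' hi').2]
    · refine List.ext_getElem (by simp) fun i hi _ => ?_
      simp only [List.getElem_map, List.getElem_range, List.getElem_ofFn]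
      exact hc i (by simpa using hi)
  refine Prog.wp_call ⟨t₅, s₅, hargs ▸ he, hQ _ _ ?_ ?_⟩
  · rw [hargs]
    simp only [List.map_cons, List.map_nil, List.sum_cons, List.sum_nil, NExp.cost, NExp.cost_var,
      NExp.eval, NExp.eval_var, hG₄.card] at ht₃ ht₄ ⊢
    have : es.length * (60 * n + 60 + (1 + 1) + 10) = 60 * (n * es.length) + 72 * es.length := by
      ring
    rw [this] at ht₃
    have := Nat.zero_le (n * es.length)
    omega
  · simpa [Store.ret, NExp.eval_var, hG₄.card] using hopt

/-- The algorithm. -/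
def mainProg (p q : Prog) : Prog :=
  .ite (.natEq (.var 0) (.lit 0)) .skip (.seq (pairsProg p) (lpProg q))

theorem reads_getD {α : Type*} (l : List α) (d : α) : Reads (fun i => l.getD i d) 0 l :=
  fun i hi => by simp [hi]

theorem holdsGraph_load (GR : List (GRPair (Fin n))) :
    HoldsGraph M.toMDPGraph es (M.encode es GR).load where
  card := rfl
  edges := rfl
  prob := reads_getD _ _
  src := reads_getD _ _
  tgt := reads_getD _ _

theorem holdsPairs_load (GR : List (GRPair (Fin n))) : HoldsPairs GR (M.encode es GR).load where
  card := rfl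
  len := reads_getD _ _
  F := reads_getD _ _
  I := reads_getD _ _

theorem size_encode (GR : List (GRPair (Fin n))) :
    (M.encode es GR).size =
      3 + n + 3 * es.length + GR.length + GR.length * n + sumLen GR * n := by
  have h1 : (GR.map fun p => bits p.F).flatten.length = GR.length * n := by
    have := length_flatten_bits (GR.map GRPair.F)
    simpa [Function.comp_def] using this
  have h2 : (GR.map fun p => (p.I.map bits).flatten).flatten.length = sumLen GR * n := by
    induction GR with
    | nil => simp [sumLen]
    | cons g GR ih =>
      have hs : sumLen (g :: GR) = g.I.length + sumLen GR := by simp [sumLen]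
      rw [List.map_cons, List.flatten_cons, List.length_append, length_flatten_bits,
        ih (by simpa [Function.comp_def] using length_flatten_bits (GR.map GRPair.F)), hs]
      ring
  simp only [Input.size, MDP.encode, List.map_cons, List.map_nil, List.sum_cons, List.sum_nil,
    List.length_cons, List.length_nil, List.length_map, length_bits, h1, h2]
  ring

/-- The overhead is of order `k * (n + m) + n * l + n * m + n + m + 1`. The first term is absorbed
by `k * TMEC n m`, and all but `n * l` of the others by `TLP n m`, through the lower bounds `hTM`
and `hTL`. -/
theorem grpSolvableIn {TMEC TLP : ℕ → ℕ → ℕ} (hM : MECSolvableIn TMEC) (hL : LPSolvableIn TLP) :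
    GRPSolvableIn fun n m k l => 1000 * (k * TMEC n m + n * l) + 1000 * TLP n m := by
  obtain ⟨p, hp⟩ := hM
  obtain ⟨q, hq⟩ := hL
  refine ⟨mainProg p q, fun n M es GR hes => ?_⟩
  -- Any admissible bound is at least the size of an input it covers, here the given graph itself.
  have hTM : 2 + n + 2 * es.length ≤ TMEC n es.length := by
    obtain ⟨t, s, -, h, -⟩ := hp n es.length n M.toMDPGraph es hes le_rfl le_rfl
    have : (M.toMDPGraph.encode es).size = 2 + n + 2 * es.length := by
      simp [Input.size, MDPGraph.encode, length_bits]; ring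
    omega
  have hqr := hq n es.length n es.length (M.reachLP (M.winning GR) es)
    ⟨_, M.reachLP_isOptimal_reachValue _ es hes⟩ le_rfl le_rfl
  have hTL : 2 + n * es.length + n + es.length ≤ TLP n es.length := by
    obtain ⟨t, s, -, h, -⟩ := hqr
    have : (M.reachLP (M.winning GR) es).encode.size = 2 + n * es.length + n + es.length := by
      simp [Input.size, LinProg.encode, Function.comp_def]; ring
    omega
  have hGk : GR.length * (2 + n + 2 * es.length) ≤ GR.length * TMEC n es.length :=
    Nat.mul_le_mul_left _ hTM
  have hk : GR.length * (2 + n + 2 * es.length) =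
      2 * GR.length + GR.length * n + 2 * (GR.length * es.length) := by ring
  have hle := hes.le_length
  have hmain : (mainProg p q).wp (M.encode es GR).load fun t s =>
      t ≤ 400 * (GR.length * TMEC n es.length) + 163 * (n * sumLen GR) + 300 * TLP n es.length ∧
      ∀ v : Fin n, s.real 0 v = (M.value (accepted GR) v).toReal := by
    -- Without vertices the term `n * l` is zero and could not pay for loops over the sets `I_i^j`,
    -- so this case is answered at once.
    refine Prog.wp_ite (fun hb => Prog.wp_skip ⟨?_, fun v => ?_⟩) (fun hb => Prog.wp_seq ?_)
    · simp only [BExp.cost, NExp.cost, NExp.cost_var]; omega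
    · have hn : n = 0 := hb
      exact absurd v.2 (by omega)
    have hn : 0 < n := Nat.pos_of_ne_zero hb
    refine wp_pairsProg (T := TMEC n es.length) hn (holdsGraph_load GR) hle
      (holdsPairs_load GR) rfl rfl (fun _ => rfl)
      (fun g _ => hp n es.length n _ _ (hes.isolate g.F) le_rfl (hes.length_isolateEdges_le g.F))
      fun t₁ s₁ ht₁ hf₁ h26 => ?_
    refine wp_lpProg (T := TLP n es.length) (W := M.winning GR)
      ((holdsGraph_load GR).frame hf₁ (by decide)) hes ?_ ?_ h26 hqr
      fun t₂ s₂ ht₂ hopt => ⟨?_, fun v => ?_⟩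
    · rw [hf₁.real 13 (by simp)]; exact fun _ => rfl
    · rw [hf₁.real 0 (by simp)]; exact reads_getD _ _
    · have h1 : GR.length * (333 * es.length + TMEC n es.length) =
          333 * (GR.length * es.length) + GR.length * TMEC n es.length := by ring
      simp only [BExp.cost, NExp.cost, NExp.cost_var]
      omega
    · rw [M.value_accepted]
      exact M.eq_reachValue_of_isOptimal _ es hes hopt v
  obtain ⟨t, s, he, ht, hv⟩ := hmain
  refine ⟨t, s, he, ?_, hv⟩
  have h1 : sumLen GR * n = n * sumLen GR := mul_comm _ _
  rw [size_encode]
  dsimp only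
  omega

end LinProgProgram

end GRPModel

theorem theorem10 :
    (∀ (n : ℕ) (M : GRPModel.MDP (Fin n)) (GR : List (GRPModel.GRPair (Fin n))) (v : Fin n),
      IsGreatest
        (Set.range fun σ : M.Strategy => M.law σ v (GRPModel.reach (M.winning GR)))
        (M.value (GRPModel.accepted GR) v)) ∧
    (∃ C : ℕ, ∀ TMEC TLP : ℕ → ℕ → ℕ,
      GRPModel.MECSolvableIn TMEC → GRPModel.LPSolvableIn TLP →
        GRPModel.GRPSolvableIn fun n m k l =>
          C * (k * TMEC n m + n * l) + C * TLP n m) :=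
  ⟨fun _ M GR v => M.isGreatest_value_accepted GR v, 1000, fun _ _ => GRPModel.grpSolvableIn⟩
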